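/- Let $(R,\mathfrak m)$ be a Noetherian local ring and let $M$ be a generalized Cohen–Macaulay $R$-module of dimension $d>0$; that is, $M$ is finitely generated of Krull dimension $d>0$ and there is a positive integer $k$ with $\mathfrak m^kH^i_{\mathfrak m}(M)=0$ for all $i<d$, where $H^i_{\mathfrak m}$ denotes the $i$-th local cohomology with respect to $\mathfrak m$. Let $n_0$ be the least positive integer such that $\mathfrak m^{n_0}H^i_{\mathfrak m}(M)=0$ for all $i<d$. Call $x\in\mathfrak m$ a parameter element of $M$ if $\dim M/xM=d-1$, and for an $R$-module $N$ write $0:_N\mathfrak m^{n_0}=\{z\in N : \mathfrak m^{n_0}z=0\}$. Then for every parameter element $x\in\mathfrak m^{2n_0}$ of $M$ there are isomorphisms of $R$-modules $$H^i_{\mathfrak m}(M/xM)\cong H^i_{\mathfrak m}(M)\oplus H^{i+1}_{\mathfrak m}(M)\qquad\text{for all } i<d-1,$$ and $$0:_{H^{d-1}_{\mathfrak m}(M/xM)}\mathfrak m^{n_0}\;\cong\; H^{d-1}_{\mathfrak m}(M)\,\oplus\, \bigl(0:_{H^{d}_{\mathfrak m}(M)}\mathfrak m^{n_0}\bigr).$$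 In particular, there is a positive integer $n$ such that for every parameter element $x$ of $M$ contained in $\mathfrak m^n$ one has $H^i_{\mathfrak m}(M/xM)\cong H^i_{\mathfrak m}(M)\oplus H^{i+1}_{\mathfrak m}(M)$ for all $i<d-1$. -/

import Mathlib

universe u

open IsLocalRing

/-- The `i`-th local cohomology module of `M` with respect to the maximal ideal of the local
ring `R` (the direct limit of the modules `Ext^i(R/𝔪^t, M)`). -/
noncomputable abbrev maxLocalCohomology (R : Type u) [CommRing R] [IsLocalRing R]
    (M : Type u) [AddCommGroup M] [Module R M] (i : ℕ) : ModuleCat.{u} R :=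
  (localCohomology (maximalIdeal R) i).obj (ModuleCat.of R M)

/-- `𝔪 ^ k` annihilates the local cohomology modules of `M` in all degrees `i < d`. -/
def AnnihilatesLocalCohomologyBelow (R : Type u) [CommRing R] [IsLocalRing R]
    (M : Type u) [AddCommGroup M] [Module R M] (d k : ℕ) : Prop :=
  ∀ i < d, (maximalIdeal R ^ k) • (⊤ : Submodule R (maxLocalCohomology R M i)) = ⊥

/-- `M` is a generalized Cohen-Macaulay module of (positive) dimension `d`. -/
structure IsGeneralizedCohenMacaulay (R : Type u) [CommRing R] [IsLocalRing R]
    (M : Type u) [AddCommGroup M] [Module R M] (d : ℕ) : Prop where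
  finite : Module.Finite R M
  pos : 0 < d
  dim_eq : Module.supportDim R M = (d : WithBot ℕ∞)
  exists_annihilates : ∃ k : ℕ, 0 < k ∧ AnnihilatesLocalCohomologyBelow R M d k

/-- `x` is a parameter element of `M`: `x ∈ 𝔪` and `dim M/xM = dim M - 1`. -/
def IsParameterElement (R : Type u) [CommRing R] [IsLocalRing R]
    (M : Type u) [AddCommGroup M] [Module R M] (x : R) : Prop :=
  x ∈ maximalIdeal R ∧
    Module.supportDim R (QuotSMulTop x M) + 1 = Module.supportDim R M

/-- The submodule `0 :_N 𝔪 ^ k` of the elements of `N` killed by `𝔪 ^ k`. -/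
abbrev annihilatedByMaxPow (R : Type u) [CommRing R] [IsLocalRing R]
    (N : Type u) [AddCommGroup N] [Module R N] (k : ℕ) : Submodule R N :=
  Submodule.torsionBySet R N ((maximalIdeal R ^ k : Ideal R) : Set R)

/-! Write `J` for the maximal ideal, `I = J ^ n₀` and `U = H⁰_J(M)`. The ideal `I` kills `U`, and
for a parameter element `x` the submodule `0 :_M x` lies in `U`. Hence multiplication by `x` induces
an injection `φ : M/U → M` with cokernel `M/xM`. Since `U` is `J`-power torsion, its higher local
cohomology vanishes, so `H^{i+1}(M/U) ≅ H^{i+1}(M)`, and the long exact sequence of `φ` relates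
`H^i(M)`, `H^i(M/xM)` and `H^{i+1}(M)`.

As `x ∈ I * I`, write `x = ∑ a_j b_j` with `a_j, b_j ∈ I`. Then `φ = α ∘ β`, where `β : M/U → M^r`
has coordinates `b_j` and `α : M^r → M` has coefficients `a_j`. For `i < d` the map `H^i(α)` is
zero, hence so is `H^i(φ)`, and `H^i(M) → H^i(M/xM)` is injective. The kernel of `H^{i+1}(β)`
contains every class killed by `I`, so such a class comes from `H^i(coker β)`. Its image in
`H^i(M/xM)` does not depend on the lift, because the ambiguity comes from `H^i(M^r)` and dies under
`H^i(α)`. This gives a linear section of the connecting map over `0 :_{H^{i+1}(M)} I`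
(`exists_section_lc_quotSMulTop`). If `I` kills `H^{i+1}(M)` the whole sequence splits; in degree `d
- 1` the splitting is obtained on the parts killed by `I`.

The inclusion `0 :_M x ⊆ U` is a dimension count: a submodule of `M` that is not `J`-power torsion
has dimension at least `d` (`natCast_le_supportDim_of_not_isPowTorsion`), while `0 :_M x` is
supported on `M/xM`.

The long exact sequence is obtained by comparing the derived-functor `Ext` in the definition of
local cohomology with `Abelian.Ext` and passing to the colimit. -/

open CategoryTheory Opposite Limits

/-! ### Cocycle representatives of cohomology classes. -/

section HomologyClass

variable {R : Type u} [CommRing R] (K L : CochainComplex (ModuleCat.{u} R) ℕ) (n : ℕ)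

/-- The cohomology class of a cocycle, for a cochain complex of modules. -/
noncomputable def cohomologyClass :
    ModuleCat.of R (LinearMap.ker (K.d n (n + 1)).hom) ⟶ K.homology n :=
  K.liftCycles (ModuleCat.ofHom (LinearMap.ker (K.d n (n + 1)).hom).subtype) (n + 1) (by simp)
    (by ext x; exact x.2) ≫ K.homologyπ n

lemma iCycles_liftCycles_apply (x : LinearMap.ker (K.d n (n + 1)).hom) :
    K.iCycles n (K.liftCycles
      (ModuleCat.ofHom (LinearMap.ker (K.d n (n + 1)).hom).subtype) (n + 1) (by simp)
      (by ext x; exact x.2) x) = x.1 := by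
  rw [← ModuleCat.comp_apply, HomologicalComplex.liftCycles_i]
  rfl

lemma cohomologyClass_surjective : Function.Surjective (cohomologyClass K n) := by
  intro z
  obtain ⟨y, rfl⟩ := (ModuleCat.epi_iff_surjective (K.homologyπ n)).1 inferInstance z
  have hy : K.d n (n + 1) (K.iCycles n y) = 0 := by
    have := K.iCycles_d n (n + 1)
    exact congr($this y)
  refine ⟨⟨K.iCycles n y, hy⟩, ?_⟩
  rw [cohomologyClass, ModuleCat.comp_apply]
  congr 1
  apply (ModuleCat.mono_iff_injective (K.iCycles n)).1 inferInstance
  rw [← ModuleCat.comp_apply, HomologicalComplex.liftCycles_i]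
  rfl

/-- In degree `0` the index `prev 0` is `0` itself and the differential is zero, so the criterion
then reads `x = 0`. -/
lemma cohomologyClass_eq_zero_iff (x) :
    cohomologyClass K n x = 0 ↔ ∃ y, K.d ((ComplexShape.up ℕ).prev n) n y = x.1 := by
  have hex := ShortComplex.exact_of_g_is_cokernel
    (ShortComplex.mk (K.toCycles ((ComplexShape.up ℕ).prev n) n) (K.homologyπ n) (by simp))
    (K.homologyIsCokernel ((ComplexShape.up ℕ).prev n) n rfl)
  rw [ShortComplex.moduleCat_exact_iff] at hex
  have hi := (ModuleCat.mono_iff_injective (K.iCycles n)).1 inferInstance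
  have hl := iCycles_liftCycles_apply K n
  have ht (y) : K.iCycles n (K.toCycles ((ComplexShape.up ℕ).prev n) n y) =
      K.d ((ComplexShape.up ℕ).prev n) n y := by
    rw [← ModuleCat.comp_apply, HomologicalComplex.toCycles_i]
  rw [cohomologyClass, ModuleCat.comp_apply]
  constructor
  · intro h
    obtain ⟨y, hy⟩ := hex _ h
    refine ⟨y, ?_⟩
    rw [← ht, ← hl]
    exact congrArg _ hy
  · rintro ⟨y, hy⟩
    rw [← ht, ← hl] at hy
    rw [← hi hy, ← ModuleCat.comp_apply]
    simp

variable {K L}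

lemma homologyMap_cohomologyClass (φ : K ⟶ L) (x : LinearMap.ker (K.d n (n + 1)).hom)
    (hx : L.d n (n + 1) (φ.f n x.1) = 0) :
    HomologicalComplex.homologyMap φ n (cohomologyClass K n x) =
      cohomologyClass L n ⟨φ.f n x.1, hx⟩ := by
  have h (y : K.cycles n) : HomologicalComplex.homologyMap φ n (K.homologyπ n y) =
      L.homologyπ n (HomologicalComplex.cyclesMap φ n y) :=
    congr($(HomologicalComplex.homologyπ_naturality φ n) y)
  refine (h _).trans (congrArg (L.homologyπ n) ?_)
  apply (ModuleCat.mono_iff_injective (L.iCycles n)).1 inferInstance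
  have h1 (y : K.cycles n) : L.iCycles n (HomologicalComplex.cyclesMap φ n y) =
      φ.f n (K.iCycles n y) :=
    congr($(HomologicalComplex.cyclesMap_i φ n) y)
  exact (h1 _).trans ((congrArg _ (iCycles_liftCycles_apply K n x)).trans
    (iCycles_liftCycles_apply L n ⟨_, hx⟩).symm)

end HomologyClass

/-! ### Derived-functor `Ext` computed on a projective resolution, naturally in both variables. -/

section OldExt

variable {C : Type*} [Category* C] [Abelian C]

/-- The morphism of opposite complexes induced by a morphism of complexes in `Cᵒᵖ`. -/
@[simps]
def unopComplexMap {ι : Type*} {c : ComplexShape ι}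
    {K L : HomologicalComplex Cᵒᵖ c} (φ : K ⟶ L) : L.unop ⟶ K.unop where
  f i := (φ.f i).unop
  comm' i j _ := congrArg Quiver.Hom.unop (φ.comm j i).symm

lemma homologyUnop_inv_naturality {ι : Type*} {c : ComplexShape ι}
    {K L : HomologicalComplex Cᵒᵖ c} (φ : K ⟶ L) (i : ι) :
    (HomologicalComplex.homologyMap φ i).unop ≫ (K.homologyUnop i).inv =
      (L.homologyUnop i).inv ≫ HomologicalComplex.homologyMap (unopComplexMap φ) i := by
  rw [Iso.eq_inv_comp, ← Category.assoc, Iso.comp_inv_eq]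
  apply Quiver.Hom.op_inj
  exact HomologicalComplex.homologyOp_hom_naturality (unopComplexMap φ) i

variable {R : Type u} [CommRing R]

/-- The map on Hom complexes given by postcomposition. -/
noncomputable def linearYonedaObjMap (P : ChainComplex (ModuleCat.{u} R) ℕ)
    {N N' : ModuleCat.{u} R} (g : N ⟶ N') :
    P.linearYonedaObj R N ⟶ P.linearYonedaObj R N' :=
  unopComplexMap ((NatTrans.mapHomologicalComplex
    (NatTrans.rightOp ((linearYoneda R (ModuleCat.{u} R)).map g)) _).app P)

/-- The map on Hom complexes given by precomposition. -/
noncomputable def linearYonedaObjPrecomp {P Q : ChainComplex (ModuleCat.{u} R) ℕ}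
    (φ : P ⟶ Q) (N : ModuleCat.{u} R)  :
    Q.linearYonedaObj R N ⟶ P.linearYonedaObj R N :=
  unopComplexMap (((((linearYoneda R (ModuleCat.{u} R)).obj N).rightOp).mapHomologicalComplex _).map φ)

open ProjectiveResolution

lemma isoExt_hom_naturality {X N N' : ModuleCat.{u} R} (P : ProjectiveResolution X) (n : ℕ)
    (g : N ⟶ N') :
    ((Ext R (ModuleCat.{u} R) n).obj (op X)).map g ≫ (P.isoExt (R := R) n N').hom =
      (P.isoExt (R := R) n N).hom ≫
        HomologicalComplex.homologyMap (linearYonedaObjMap P.complex g) n := by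
  have h1 := homologyUnop_inv_naturality
    ((NatTrans.mapHomologicalComplex (NatTrans.rightOp ((linearYoneda R (ModuleCat.{u} R)).map g))
      (ComplexShape.down ℕ)).app P.complex) n
  have h2 : ((Ext R (ModuleCat.{u} R) n).obj (op X)).map g = ((NatTrans.leftDerived
    (NatTrans.rightOp ((linearYoneda R (ModuleCat.{u} R)).map g)) n).app X).unop := rfl
  have h3 : (P.isoLeftDerivedObj ((linearYoneda R (ModuleCat.{u} R)).obj N').rightOp n).inv ≫
      (NatTrans.leftDerived
        (NatTrans.rightOp ((linearYoneda R (ModuleCat.{u} R)).map g)) n).app X =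
      (HomologicalComplex.homologyFunctor _ (ComplexShape.down ℕ) n).map
        ((NatTrans.mapHomologicalComplex
          (NatTrans.rightOp ((linearYoneda R (ModuleCat.{u} R)).map g)) _).app P.complex) ≫
        (P.isoLeftDerivedObj ((linearYoneda R (ModuleCat.{u} R)).obj N).rightOp n).inv := by
    rw [ProjectiveResolution.leftDerived_app_eq _ P n, Iso.inv_hom_id_assoc]
  have h4 := congrArg Quiver.Hom.unop h3
  rw [unop_comp, unop_comp, ← h2] at h4
  exact (Category.assoc _ _ _).symm.trans ((congrArg (· ≫ _) h4).trans
    ((Category.assoc _ _ _).trans ((congrArg (_ ≫ ·) h1).trans (Category.assoc _ _ _).symm)))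

lemma isoExt_hom_precomp {X X' N : ModuleCat.{u} R} (P : ProjectiveResolution X)
    (P' : ProjectiveResolution X') (n : ℕ)
    {g : X ⟶ X'} (φ : Hom P P' g) :
    ((Ext R (ModuleCat.{u} R) n).map g.op).app N ≫ (P.isoExt (R := R) n N).hom =
      (P'.isoExt (R := R) n N).hom ≫
        HomologicalComplex.homologyMap (linearYonedaObjPrecomp φ.hom N) n := by
  have h1 := homologyUnop_inv_naturality
    (((((linearYoneda R (ModuleCat.{u} R)).obj N).rightOp).mapHomologicalComplex
      (ComplexShape.down ℕ)).map φ.hom) n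
  have h2 : ((Ext R (ModuleCat.{u} R) n).map g.op).app N =
    ((((linearYoneda R (ModuleCat.{u} R)).obj N).rightOp.leftDerived n).map g).unop := rfl
  have h3 := ProjectiveResolution.isoLeftDerivedObj_inv_naturality g P P' φ.hom
    φ.hom_f_zero_comp_π_f_zero ((linearYoneda R (ModuleCat.{u} R)).obj N).rightOp n
  have h4 := congrArg Quiver.Hom.unop h3
  rw [unop_comp, unop_comp, ← h2] at h4
  exact (Category.assoc _ _ _).symm.trans ((congrArg (· ≫ _) h4).trans
    ((Category.assoc _ _ _).trans ((congrArg (_ ≫ ·) h1).trans (Category.assoc _ _ _).symm)))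

end OldExt

/-! ### Comparison of the two constructions of `Ext`. -/

section ExtComparison

variable {R : Type u} [CommRing R] {X X' N N' : ModuleCat.{u} R}
  (P : ProjectiveResolution X) (P' : ProjectiveResolution X') {n : ℕ}

/-- The class in `Ext R (ModuleCat R) n` of a cocycle on a projective resolution. -/
noncomputable def extClassOfCocycle (f : P.complex.X n ⟶ N)
    (hf : P.complex.d (n + 1) n ≫ f = 0) :
    ((Ext R (ModuleCat.{u} R) n).obj (op X)).obj N :=
  (P.isoExt n N).inv (cohomologyClass (P.complex.linearYonedaObj R N) n ⟨f, hf⟩)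

lemma isoExt_hom_extClassOfCocycle (f : P.complex.X n ⟶ N)
    (hf : P.complex.d (n + 1) n ≫ f = 0) :
    (P.isoExt (R := R) n N).hom (extClassOfCocycle P f hf) =
      cohomologyClass (P.complex.linearYonedaObj R N) n ⟨f, hf⟩ :=
  (P.isoExt n N).inv_hom_id_apply _

lemma extClassOfCocycle_add (f g : P.complex.X n ⟶ N)
    (hf : P.complex.d (n + 1) n ≫ f = 0) (hg : P.complex.d (n + 1) n ≫ g = 0)
    (hfg : P.complex.d (n + 1) n ≫ (f + g) = 0) :
    extClassOfCocycle P (f + g) hfg = extClassOfCocycle P f hf + extClassOfCocycle P g hg := by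
  have h : (⟨f + g, hfg⟩ :
      LinearMap.ker ((P.complex.linearYonedaObj R N).d n (n + 1)).hom) = ⟨f, hf⟩ + ⟨g, hg⟩ := rfl
  simp only [extClassOfCocycle]
  rw [← map_add]
  congr 1
  exact (congrArg _ h).trans (map_add (cohomologyClass (P.complex.linearYonedaObj R N) n).hom _ _)

lemma extClassOfCocycle_surjective (z : ((Ext R (ModuleCat.{u} R) n).obj (op X)).obj N) :
    ∃ (f : P.complex.X n ⟶ N) (hf : P.complex.d (n + 1) n ≫ f = 0),
      extClassOfCocycle P f hf = z := by
  obtain ⟨⟨f, hf⟩, h⟩ := cohomologyClass_surjective _ n ((P.isoExt n N).hom z)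
  refine ⟨f, hf, ?_⟩
  exact (congrArg (P.isoExt n N).inv h).trans ((P.isoExt n N).hom_inv_id_apply z)

lemma extClassOfCocycle_eq_zero_iff (f : P.complex.X n ⟶ N)
    (hf : P.complex.d (n + 1) n ≫ f = 0) :
    extClassOfCocycle P f hf = 0 ↔
      ∃ g : P.complex.X ((ComplexShape.up ℕ).prev n) ⟶ N, P.complex.d n _ ≫ g = f := by
  have h := cohomologyClass_eq_zero_iff (P.complex.linearYonedaObj R N) n ⟨f, hf⟩
  refine Iff.trans ?_ h
  have hi : Function.Injective (P.isoExt (R := R) n N).inv :=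
    (ModuleCat.mono_iff_injective _).1 inferInstance
  rw [extClassOfCocycle]
  constructor
  · intro h
    apply hi
    rw [h, map_zero]
  · intro h
    erw [h, map_zero]

/-- Both constructions represent classes by cocycles on the same resolution, and in both a class
vanishes exactly when the cocycle is a coboundary. Degree `0` is separate: there are no nonzero
coboundaries. -/
lemma extClassOfCocycle_eq_zero_iff_extMk (f : P.complex.X n ⟶ N)
    (hf : P.complex.d (n + 1) n ≫ f = 0) :
    extClassOfCocycle P f hf = 0 ↔ P.extMk f (n + 1) rfl hf = 0 := by
  rw [extClassOfCocycle_eq_zero_iff]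
  rcases n with - | n
  · simp only [← P.extEquivCohomologyClass.apply_eq_iff_eq,
      ProjectiveResolution.extEquivCohomologyClass_extMk,
      ProjectiveResolution.extEquivCohomologyClass_zero,
      CochainComplex.HomComplex.CohomologyClass.mk_eq_zero_iff]
    rw [CochainComplex.HomComplex.Cocycle.toSingleMk_mem_coboundaries_iff _ _ _ _ _ 1 (by simp)]
    have h0 : P.complex.d 0 ((ComplexShape.up ℕ).prev 0) = 0 :=
      P.complex.shape _ _ (by simp)
    have h1 : P.cochainComplex.d (-(0 : ℕ) : ℤ) 1 = 0 :=
      (P.cochainComplex.isZero_of_isStrictlyLE 0 1 (by simp)).eq_of_tgt _ _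
    rw [h0, h1]
    simp only [Limits.zero_comp, exists_const]
    constructor
    · intro h
      simp [← h]
    · intro h
      rw [← cancel_epi (P.cochainComplexXIso (-(0 : ℕ) : ℤ) 0 rfl).hom, ← h]
      simp
  · rw [P.extMk_eq_zero_iff f (n + 1 + 1) rfl hf n rfl]
    have : (ComplexShape.up ℕ).prev (n + 1) = n := by simp
    rw [this]

lemma map_extClassOfCocycle (f : P.complex.X n ⟶ N)
    (hf : P.complex.d (n + 1) n ≫ f = 0) (g : N ⟶ N') (hg) :
    ((Ext R (ModuleCat.{u} R) n).obj (op X)).map g (extClassOfCocycle P f hf) =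
      extClassOfCocycle P (f ≫ g) hg := by
  have hi : Function.Injective (P.isoExt (R := R) n N').hom :=
    (ModuleCat.mono_iff_injective _).1 inferInstance
  apply hi
  have h1 := congr($(isoExt_hom_naturality P n g) (extClassOfCocycle P f hf))
  have h2 := homologyMap_cohomologyClass n (linearYonedaObjMap P.complex g) ⟨f, hf⟩ hg
  have h3 : HomologicalComplex.homologyMap (linearYonedaObjMap P.complex g) n
      ((P.isoExt n N).hom (extClassOfCocycle P f hf)) = _ :=
    (congrArg _ (isoExt_hom_extClassOfCocycle P f hf)).trans h2
  exact h1.trans (h3.trans (isoExt_hom_extClassOfCocycle P _ hg).symm)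

variable {P P'} in
lemma map_extClassOfCocycle_precomp (f : P'.complex.X n ⟶ N)
    (hf : P'.complex.d (n + 1) n ≫ f = 0) {g : X ⟶ X'} (φ : ProjectiveResolution.Hom P P' g) (hg) :
    ((Ext R (ModuleCat.{u} R) n).map g.op).app N (extClassOfCocycle P' f hf) =
      extClassOfCocycle P (φ.hom.f n ≫ f) hg := by
  have hi : Function.Injective (P.isoExt (R := R) n N).hom :=
    (ModuleCat.mono_iff_injective _).1 inferInstance
  apply hi
  have h1 := congr($(isoExt_hom_precomp (N := N) P P' n φ) (extClassOfCocycle P' f hf))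
  have h2 := homologyMap_cohomologyClass n (linearYonedaObjPrecomp φ.hom N) ⟨f, hf⟩ hg
  have h3 : HomologicalComplex.homologyMap (linearYonedaObjPrecomp φ.hom N) n
      ((P'.isoExt n N).hom (extClassOfCocycle P' f hf)) = _ :=
    (congrArg _ (isoExt_hom_extClassOfCocycle P' f hf)).trans h2
  exact h1.trans (h3.trans (isoExt_hom_extClassOfCocycle P _ hg).symm)

lemma extClassOfCocycle_sub (f g : P.complex.X n ⟶ N)
    (hf : P.complex.d (n + 1) n ≫ f = 0) (hg : P.complex.d (n + 1) n ≫ g = 0)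
    (hfg : P.complex.d (n + 1) n ≫ (f - g) = 0) :
    extClassOfCocycle P (f - g) hfg = extClassOfCocycle P f hf - extClassOfCocycle P g hg := by
  rw [eq_sub_iff_add_eq, ← extClassOfCocycle_add _ _ _ _ _ (by simpa using hf)]
  simp

lemma extClassOfCocycle_eq_iff_extMk (f g : P.complex.X n ⟶ N)
    (hf : P.complex.d (n + 1) n ≫ f = 0) (hg : P.complex.d (n + 1) n ≫ g = 0) :
    extClassOfCocycle P f hf = extClassOfCocycle P g hg ↔
      P.extMk f (n + 1) rfl hf = P.extMk g (n + 1) rfl hg := by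
  have hfg : P.complex.d (n + 1) n ≫ (f - g) = 0 := by simp [hf, hg]
  rw [← sub_eq_zero, ← sub_eq_zero (a := P.extMk _ _ _ _), P.sub_extMk,
    ← extClassOfCocycle_sub _ _ _ _ _ hfg, extClassOfCocycle_eq_zero_iff_extMk]

variable (X N n) in
/-- The comparison between the `Ext` groups defined via the derived category and those defined
as left derived functors. -/
noncomputable def extComparison :
    Abelian.Ext.{u} X N n ≃+ ((Ext R (ModuleCat.{u} R) n).obj (op X)).obj N where
  -- Any representing cocycle may be chosen: by `extClassOfCocycle_eq_iff_extMk` two cocycles have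
  -- equal classes on one side iff they do on the other.
  toFun α := extClassOfCocycle (projectiveResolution X)
    ((projectiveResolution X).extMk_surjective α (n + 1) rfl).choose
    ((projectiveResolution X).extMk_surjective α (n + 1) rfl).choose_spec.choose
  invFun z := (projectiveResolution X).extMk
    (extClassOfCocycle_surjective (projectiveResolution X) z).choose (n + 1) rfl
    (extClassOfCocycle_surjective (projectiveResolution X) z).choose_spec.choose
  left_inv α := by
    refine Eq.trans ?_ ((projectiveResolution X).extMk_surjective α (n + 1) rfl).choose_spec.choose_spec
    rw [← extClassOfCocycle_eq_iff_extMk]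
    exact (extClassOfCocycle_surjective (projectiveResolution X) _).choose_spec.choose_spec
  right_inv z := by
    refine Eq.trans ?_
      (extClassOfCocycle_surjective (projectiveResolution X) z).choose_spec.choose_spec
    rw [extClassOfCocycle_eq_iff_extMk]
    exact ((projectiveResolution X).extMk_surjective _ (n + 1) rfl).choose_spec.choose_spec
  map_add' α β := by
    have h1 := ((projectiveResolution X).extMk_surjective α (n + 1) rfl).choose_spec
    have h2 := ((projectiveResolution X).extMk_surjective β (n + 1) rfl).choose_spec
    have h3 := ((projectiveResolution X).extMk_surjective (α + β) (n + 1) rfl).choose_spec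
    rw [← extClassOfCocycle_add _ _ _ h1.choose h2.choose (by simp [h1.choose, h2.choose]),
      extClassOfCocycle_eq_iff_extMk, h3.choose_spec, ← (projectiveResolution X).add_extMk _ _ _ rfl h1.choose h2.choose,
      h1.choose_spec, h2.choose_spec]

lemma extComparison_extMk (f : (projectiveResolution X).complex.X n ⟶ N)
    (hf : (projectiveResolution X).complex.d (n + 1) n ≫ f = 0) :
    extComparison X N n ((projectiveResolution X).extMk f (n + 1) rfl hf) =
      extClassOfCocycle (projectiveResolution X) f hf := by
  refine (extClassOfCocycle_eq_iff_extMk (projectiveResolution X) _ _ _ _).2 ?_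
  exact ((projectiveResolution X).extMk_surjective _ (n + 1) rfl).choose_spec.choose_spec

lemma map_extComparison (α : Abelian.Ext.{u} X N n) (g : N ⟶ N') :
    ((Ext R (ModuleCat.{u} R) n).obj (op X)).map g (extComparison X N n α) =
      extComparison X N' n (α.comp (Abelian.Ext.mk₀ g) (add_zero n)) := by
  obtain ⟨f, hf, rfl⟩ := (projectiveResolution X).extMk_surjective α (n + 1) rfl
  rw [extComparison_extMk, ProjectiveResolution.extMk_comp_mk₀, extComparison_extMk]
  exact map_extClassOfCocycle _ _ _ _ _

lemma map_extComparison_precomp (α : Abelian.Ext.{u} X' N n) (g : X ⟶ X') :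
    ((Ext R (ModuleCat.{u} R) n).map g.op).app N (extComparison X' N n α) =
      extComparison X N n ((Abelian.Ext.mk₀ g).comp α (zero_add n)) := by
  obtain ⟨f, hf, rfl⟩ := (projectiveResolution X').extMk_surjective α (n + 1) rfl
  let φ : ProjectiveResolution.Hom (projectiveResolution X) (projectiveResolution X') g :=
    { hom := ProjectiveResolution.lift g _ _
      hom_f_zero_comp_π_f_zero := ProjectiveResolution.lift_commutes_zero g _ _ }
  rw [extComparison_extMk, ProjectiveResolution.mk₀_comp_extMk _ _ _ _ φ, extComparison_extMk]
  exact map_extClassOfCocycle_precomp _ _ φ _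

end ExtComparison

/-! ### Local cohomology as a colimit: elements come from some `Ext^n(R/J^t, N)` and vanish at a
finite stage. -/

section LocalCohomologyClass

variable {R : Type u} [CommRing R] (J : Ideal R)

/-- The module `R ⧸ J ^ t`. -/
abbrev quotPow (t : ℕ) : ModuleCat.{u} R := ModuleCat.of R (R ⧸ J ^ t)

/-- The projection `R ⧸ J ^ s ⟶ R ⧸ J ^ t` for `t ≤ s`. -/
abbrev quotPowMap {t s : ℕ} (h : t ≤ s) : quotPow J s ⟶ quotPow J t :=
  ModuleCat.ofHom <| Submodule.mapQ _ _ LinearMap.id (Ideal.pow_le_pow_right h)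

variable (n : ℕ) (N : ModuleCat.{u} R)

/-- The class in local cohomology of an element of `Ext^n(R/J^t, N)`. -/
noncomputable def localCohomologyClass (t : ℕ) :
    Abelian.Ext.{u} (quotPow J t) N n →+ (localCohomology J n).obj N :=
  AddMonoidHom.comp (((colimit.ι (localCohomology.diagram
    (localCohomology.idealPowersDiagram J) n) (op (op t))).app N).hom.toAddMonoidHom)
    (extComparison (quotPow J t) N n).toAddMonoidHom

variable {J n N}

lemma localCohomologyClass_quotPowMap {t s : ℕ} (h : t ≤ s)
    (α : Abelian.Ext.{u} (quotPow J t) N n) :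
    localCohomologyClass J n N s
      ((Abelian.Ext.mk₀ (quotPowMap J h)).comp α (zero_add n)) =
      localCohomologyClass J n N t α := by
  have h1 := map_extComparison_precomp (N := N) α (quotPowMap J h)
  have h2 := colimit.w (localCohomology.diagram
    (localCohomology.idealPowersDiagram J) n)
    (show (op (op t)) ⟶ op (op s) from (homOfLE h).op.op)
  have h3 := congr(($h2).app N (extComparison (quotPow J t) N n α))
  refine Eq.trans ?_ h3
  exact congrArg ((colimit.ι (localCohomology.diagram
    (localCohomology.idealPowersDiagram J) n) (op (op s))).app N) h1.symm

lemma map_localCohomologyClass {N' : ModuleCat.{u} R} {t : ℕ} (f : N ⟶ N')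
    (α : Abelian.Ext.{u} (quotPow J t) N n) :
    (localCohomology J n).map f (localCohomologyClass J n N t α) =
      localCohomologyClass J n N' t (α.comp (Abelian.Ext.mk₀ f) (add_zero n)) := by
  have h1 := map_extComparison (R := R) α f
  have h2 := (colimit.ι (localCohomology.diagram
    (localCohomology.idealPowersDiagram J) n) (op (op t))).naturality f
  have h3 := congr($h2 (extComparison (quotPow J t) N n α))
  refine h3.symm.trans ?_
  exact congrArg ((colimit.ι (localCohomology.diagram
    (localCohomology.idealPowersDiagram J) n) (op (op t))).app N') h1

lemma exists_localCohomologyClass (z : (localCohomology J n).obj N) :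
    ∃ t α, localCohomologyClass J n N t α = z := by
  -- The index category lives in universe `0` and the modules in universe `u`.
  have := preservesFilteredColimitsOfSize_shrink.{0, u, 0, u} (forget (ModuleCat.{u} R))
  have hc := isColimitOfPreserves ((evaluation _ _).obj N) (colimit.isColimit
    (localCohomology.diagram (localCohomology.idealPowersDiagram J) n))
  obtain ⟨⟨⟨t⟩⟩, y, hy⟩ := Concrete.isColimit_exists_rep _ hc z
  refine ⟨t, (extComparison (quotPow J t) N n).symm y, ?_⟩
  refine Eq.trans ?_ hy
  exact congrArg ((colimit.ι (localCohomology.diagram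
    (localCohomology.idealPowersDiagram J) n) (op (op t))).app N)
    ((extComparison (quotPow J t) N n).apply_symm_apply y)

lemma localCohomologyClass_eq_zero_iff {t : ℕ} (α : Abelian.Ext.{u} (quotPow J t) N n) :
    localCohomologyClass J n N t α = 0 ↔
      ∃ (s : ℕ) (h : t ≤ s), (Abelian.Ext.mk₀ (quotPowMap J h)).comp α (zero_add n) = 0 := by
  constructor
  · intro hz
    have := preservesFilteredColimitsOfSize_shrink.{0, u, 0, u} (forget (ModuleCat.{u} R))
    have hc := isColimitOfPreserves ((evaluation _ _).obj N) (colimit.isColimit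
      (localCohomology.diagram (localCohomology.idealPowersDiagram J) n))
    have h0 : (((evaluation _ _).obj N).mapCocone (colimit.cocone
      (localCohomology.diagram (localCohomology.idealPowersDiagram J) n))).ι.app (op (op t))
        (extComparison (quotPow J t) N n α) =
      (((evaluation _ _).obj N).mapCocone (colimit.cocone
      (localCohomology.diagram (localCohomology.idealPowersDiagram J) n))).ι.app (op (op t)) 0 :=
      hz.trans (map_zero _).symm
    obtain ⟨⟨⟨s⟩⟩, f, g, hfg⟩ := Concrete.isColimit_exists_of_rep_eq _ hc _ _ h0
    have hts : t ≤ s := leOfHom f.unop.unop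
    refine ⟨s, hts, ?_⟩
    have h1 := map_extComparison_precomp (N := N) α (quotPowMap J hts)
    apply (extComparison (quotPow J s) N n).injective
    rw [← h1, map_zero]
    exact hfg.trans (map_zero _)
  · rintro ⟨s, h, hs⟩
    rw [← localCohomologyClass_quotPowMap h, hs, map_zero]

end LocalCohomologyClass

/-! ### Linearity and the long exact sequence of local cohomology. -/

section LongExactSequence

variable {R : Type u} [CommRing R] {J : Ideal R} {n : ℕ} {N N' : ModuleCat.{u} R}

lemma extClassOfCocycle_smul {X : ModuleCat.{u} R} (P : ProjectiveResolution X) (r : R)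
    (f : P.complex.X n ⟶ N)
    (hf : P.complex.d (n + 1) n ≫ f = 0) (hrf : P.complex.d (n + 1) n ≫ (r • f) = 0) :
    extClassOfCocycle P (r • f) hrf = r • extClassOfCocycle P f hf := by
  have h : (⟨r • f, hrf⟩ :
      LinearMap.ker ((P.complex.linearYonedaObj R N).d n (n + 1)).hom) = r • ⟨f, hf⟩ := rfl
  simp only [extClassOfCocycle]
  rw [← map_smul]
  congr 1
  exact (congrArg _ h).trans (map_smul (cohomologyClass (P.complex.linearYonedaObj R N) n).hom _ _)

lemma extComparison_smul {X : ModuleCat.{u} R} (r : R) (α : Abelian.Ext.{u} X N n) :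
    extComparison X N n (r • α) = r • extComparison X N n α := by
  obtain ⟨f, hf, rfl⟩ := (projectiveResolution X).extMk_surjective α (n + 1) rfl
  rw [Abelian.Ext.smul_eq_comp_mk₀, ProjectiveResolution.extMk_comp_mk₀, extComparison_extMk,
    extComparison_extMk, ← extClassOfCocycle_smul _ _ _ _ (by simp [hf])]
  simp

lemma localCohomologyClass_smul {t : ℕ} (r : R) (α : Abelian.Ext.{u} (quotPow J t) N n) :
    localCohomologyClass J n N t (r • α) = r • localCohomologyClass J n N t α := by
  have h1 := extComparison_smul r α
  have h2 := map_smul ((colimit.ι (localCohomology.diagram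
    (localCohomology.idealPowersDiagram J) n) (op (op t))).app N).hom r
      (extComparison (quotPow J t) N n α)
  refine Eq.trans ?_ h2
  exact congrArg ((colimit.ι (localCohomology.diagram
    (localCohomology.idealPowersDiagram J) n) (op (op t))).app N) h1

lemma localCohomology_map_smul_id (r : R) (z : (localCohomology J n).obj N) :
    (localCohomology J n).map (r • 𝟙 N) z = r • z := by
  obtain ⟨t, α, rfl⟩ := exists_localCohomologyClass z
  rw [map_localCohomologyClass, ← Abelian.Ext.smul_eq_comp_mk₀, localCohomologyClass_smul]

instance : (localCohomology J n).Additive where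
  map_add {N N' f g} := by
    ext z
    obtain ⟨t, α, rfl⟩ := exists_localCohomologyClass z
    rw [ModuleCat.hom_add, LinearMap.add_apply]
    erw [map_localCohomologyClass, map_localCohomologyClass, map_localCohomologyClass]
    rw [Abelian.Ext.mk₀_add, Abelian.Ext.comp_add, map_add]

lemma exists_localCohomologyClass_le (z : (localCohomology J n).obj N) (t : ℕ) :
    ∃ (s : ℕ) (_ : t ≤ s) (α : _), localCohomologyClass J n N s α = z := by
  obtain ⟨s, α, rfl⟩ := exists_localCohomologyClass z
  exact ⟨max t s, le_max_left _ _, _, localCohomologyClass_quotPowMap (le_max_right t s) α⟩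

variable {S S' : ShortComplex (ModuleCat.{u} R)} (hS : S.ShortExact) (hS' : S'.ShortExact)

/-- This is the well-definedness of the connecting map: representatives of one class agree after
restriction to a higher power of `J`, and restriction, being precomposition, commutes with composing
with the extension class on the other side. -/
lemma localCohomologyClass_comp_extClass {s t : ℕ} {α : Abelian.Ext.{u} (quotPow J s) S.X₃ n}
    {β : Abelian.Ext.{u} (quotPow J t) S.X₃ n}
    (h : localCohomologyClass J n _ s α = localCohomologyClass J n _ t β) :
    localCohomologyClass J (n + 1) _ s (α.comp hS.extClass rfl) =
      localCohomologyClass J (n + 1) _ t (β.comp hS.extClass rfl) := by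
  rw [← localCohomologyClass_quotPowMap (le_max_left s t),
    ← localCohomologyClass_quotPowMap (le_max_right s t), ← sub_eq_zero, ← map_sub,
    localCohomologyClass_eq_zero_iff] at h
  obtain ⟨m, hm, h⟩ := h
  rw [← localCohomologyClass_quotPowMap (le_max_left s t),
    ← localCohomologyClass_quotPowMap (le_max_right s t), ← sub_eq_zero, ← map_sub,
    localCohomologyClass_eq_zero_iff]
  refine ⟨m, hm, ?_⟩
  rw [← Abelian.Ext.comp_assoc _ _ _ (zero_add n) _ (by lia),
    ← Abelian.Ext.comp_assoc _ _ _ (zero_add n) _ (by lia), sub_eq_add_neg,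
    ← Abelian.Ext.neg_comp, ← Abelian.Ext.add_comp, ← sub_eq_add_neg,
    ← Abelian.Ext.comp_assoc _ _ _ (zero_add n) _ (by lia), h, Abelian.Ext.zero_comp]

variable (J n) in
/-- The connecting homomorphism in local cohomology. -/
noncomputable def localCohomologyδ :
    (localCohomology J n).obj S.X₃ →ₗ[R] (localCohomology J (n + 1)).obj S.X₁ where
  toFun z := localCohomologyClass J (n + 1) _ _
    ((exists_localCohomologyClass z).choose_spec.choose.comp hS.extClass rfl)
  map_add' z w := by
    obtain ⟨s, α, β, rfl, rfl⟩ : ∃ s α β, localCohomologyClass J n S.X₃ s α = z ∧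
        localCohomologyClass J n S.X₃ s β = w := by
      obtain ⟨t, α, rfl⟩ := exists_localCohomologyClass z
      obtain ⟨s, h, β, rfl⟩ := exists_localCohomologyClass_le w t
      exact ⟨s, _, _, localCohomologyClass_quotPowMap h α, rfl⟩
    rw [localCohomologyClass_comp_extClass hS (exists_localCohomologyClass
      (localCohomologyClass J n S.X₃ s α)).choose_spec.choose_spec,
      localCohomologyClass_comp_extClass hS (exists_localCohomologyClass
      (localCohomologyClass J n S.X₃ s β)).choose_spec.choose_spec]
    refine Eq.trans ?_ (map_add _ _ _)
    rw [← Abelian.Ext.add_comp]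
    apply localCohomologyClass_comp_extClass
    rw [(exists_localCohomologyClass _).choose_spec.choose_spec, map_add]
  map_smul' r z := by
    obtain ⟨t, α, rfl⟩ := exists_localCohomologyClass z
    rw [localCohomologyClass_comp_extClass hS (exists_localCohomologyClass
      (localCohomologyClass J n S.X₃ t α)).choose_spec.choose_spec, RingHom.id_apply]
    refine Eq.trans ?_ (localCohomologyClass_smul _ _)
    rw [← Abelian.Ext.smul_comp]
    apply localCohomologyClass_comp_extClass
    rw [(exists_localCohomologyClass _).choose_spec.choose_spec, localCohomologyClass_smul]

lemma localCohomologyδ_class {t : ℕ} (α : Abelian.Ext.{u} (quotPow J t) S.X₃ n) :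
    localCohomologyδ J n hS (localCohomologyClass J n _ t α) =
      localCohomologyClass J (n + 1) _ t (α.comp hS.extClass rfl) :=
  localCohomologyClass_comp_extClass hS
    (exists_localCohomologyClass (localCohomologyClass J n _ t α)).choose_spec.choose_spec

lemma localCohomologyδ_naturality (φ : S ⟶ S') (z : (localCohomology J n).obj S.X₃) :
    (localCohomology J (n + 1)).map φ.τ₁ (localCohomologyδ J n hS z) =
      localCohomologyδ J n hS' ((localCohomology J n).map φ.τ₃ z) := by
  obtain ⟨t, α, rfl⟩ := exists_localCohomologyClass z
  rw [localCohomologyδ_class, map_localCohomologyClass, map_localCohomologyClass,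
    localCohomologyδ_class, Abelian.Ext.comp_assoc_of_third_deg_zero,
    ShortComplex.ShortExact.extClass_naturality hS hS', Abelian.Ext.comp_assoc_of_second_deg_zero]

lemma localCohomologyδ_map (z : (localCohomology J n).obj S.X₂) :
    localCohomologyδ J n hS ((localCohomology J n).map S.g z) = 0 := by
  obtain ⟨t, α, rfl⟩ := exists_localCohomologyClass z
  rw [map_localCohomologyClass, localCohomologyδ_class, Abelian.Ext.comp_assoc_of_second_deg_zero,
    hS.comp_extClass, Abelian.Ext.comp_zero, map_zero]

lemma map_localCohomologyδ (z : (localCohomology J n).obj S.X₃) :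
    (localCohomology J (n + 1)).map S.f (localCohomologyδ J n hS z) = 0 := by
  obtain ⟨t, α, rfl⟩ := exists_localCohomologyClass z
  rw [localCohomologyδ_class, map_localCohomologyClass, Abelian.Ext.comp_assoc_of_third_deg_zero,
    hS.extClass_comp, Abelian.Ext.comp_zero, map_zero]

lemma localCohomology_exact₁ (z : (localCohomology J (n + 1)).obj S.X₁)
    (hz : (localCohomology J (n + 1)).map S.f z = 0) :
    ∃ w, localCohomologyδ J n hS w = z := by
  obtain ⟨t, α, rfl⟩ := exists_localCohomologyClass z
  rw [map_localCohomologyClass, localCohomologyClass_eq_zero_iff] at hz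
  obtain ⟨s, h, hs⟩ := hz
  rw [← Abelian.Ext.comp_assoc_of_third_deg_zero] at hs
  obtain ⟨w, hw⟩ := Abelian.Ext.covariant_sequence_exact₁ _ hS _ hs rfl
  refine ⟨localCohomologyClass J n _ s w, ?_⟩
  rw [localCohomologyδ_class, hw, localCohomologyClass_quotPowMap]

include hS in
lemma localCohomology_exact₂ (z : (localCohomology J n).obj S.X₂)
    (hz : (localCohomology J n).map S.g z = 0) :
    ∃ w, (localCohomology J n).map S.f w = z := by
  obtain ⟨t, α, rfl⟩ := exists_localCohomologyClass z
  rw [map_localCohomologyClass, localCohomologyClass_eq_zero_iff] at hz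
  obtain ⟨s, h, hs⟩ := hz
  rw [← Abelian.Ext.comp_assoc_of_third_deg_zero] at hs
  obtain ⟨w, hw⟩ := Abelian.Ext.covariant_sequence_exact₂ _ hS _ hs
  refine ⟨localCohomologyClass J n _ s w, ?_⟩
  rw [map_localCohomologyClass, hw, localCohomologyClass_quotPowMap]

lemma localCohomology_exact₃ (z : (localCohomology J n).obj S.X₃)
    (hz : localCohomologyδ J n hS z = 0) :
    ∃ w, (localCohomology J n).map S.g w = z := by
  obtain ⟨t, α, rfl⟩ := exists_localCohomologyClass z
  rw [localCohomologyδ_class, localCohomologyClass_eq_zero_iff] at hz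
  obtain ⟨s, h, hs⟩ := hz
  rw [← Abelian.Ext.comp_assoc _ _ _ (zero_add n) _ (by lia)] at hs
  obtain ⟨w, hw⟩ := Abelian.Ext.covariant_sequence_exact₃ _ hS _ _ hs
  refine ⟨localCohomologyClass J n _ s w, ?_⟩
  rw [map_localCohomologyClass, hw, localCohomologyClass_quotPowMap]

lemma localCohomology_succ_eq_zero_of_injective [Injective N]
    (z : (localCohomology J (n + 1)).obj N) : z = 0 := by
  obtain ⟨t, α, rfl⟩ := exists_localCohomologyClass z
  rw [α.eq_zero_of_injective, map_zero]

end LongExactSequence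

/-! ### The same theory for unbundled modules and linear maps. -/

section ModuleLevel

variable {R : Type u} [CommRing R] (J : Ideal R) (n : ℕ)
  {A B C A' B' C' : Type u} [AddCommGroup A] [AddCommGroup B] [AddCommGroup C]
  [AddCommGroup A'] [AddCommGroup B'] [AddCommGroup C']
  [Module R A] [Module R B] [Module R C] [Module R A'] [Module R B'] [Module R C']

/-- Local cohomology of an unbundled module. -/
abbrev LC {R : Type u} [CommRing R] (J : Ideal R) (n : ℕ) (A : Type u) [AddCommGroup A]
    [Module R A] : Type u :=
  (localCohomology J n).obj (ModuleCat.of R A)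

/-- The linear map induced in local cohomology. -/
noncomputable def lcMap (f : A →ₗ[R] B) : LC J n A →ₗ[R] LC J n B :=
  ((localCohomology J n).map (ModuleCat.ofHom f)).hom

lemma lcMap_id : lcMap J n (LinearMap.id : A →ₗ[R] A) = LinearMap.id :=
  congrArg ModuleCat.Hom.hom ((localCohomology J n).map_id (ModuleCat.of R A))

lemma lcMap_comp (g : B →ₗ[R] C) (f : A →ₗ[R] B) :
    lcMap J n (g ∘ₗ f) = lcMap J n g ∘ₗ lcMap J n f :=
  congrArg ModuleCat.Hom.hom
    ((localCohomology J n).map_comp (ModuleCat.ofHom f) (ModuleCat.ofHom g))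

lemma lcMap_comp_apply (g : B →ₗ[R] C) (f : A →ₗ[R] B) (z) :
    lcMap J n (g ∘ₗ f) z = lcMap J n g (lcMap J n f z) := by
  rw [lcMap_comp]; rfl

lemma lcMap_add (f g : A →ₗ[R] B) : lcMap J n (f + g) = lcMap J n f + lcMap J n g :=
  congrArg ModuleCat.Hom.hom
    ((localCohomology J n).map_add (f := ModuleCat.ofHom f) (g := ModuleCat.ofHom g))

lemma lcMap_zero : lcMap J n (0 : A →ₗ[R] B) = 0 :=
  congrArg ModuleCat.Hom.hom ((localCohomology J n).map_zero (ModuleCat.of R A) (ModuleCat.of R B))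

lemma lcMap_sum {ι : Type*} (s : Finset ι) (f : ι → (A →ₗ[R] B)) :
    lcMap J n (∑ i ∈ s, f i) = ∑ i ∈ s, lcMap J n (f i) := by
  classical
  induction s using Finset.induction_on with
  | empty => simp [lcMap_zero]
  | insert i s hi ih => rw [Finset.sum_insert hi, Finset.sum_insert hi, lcMap_add, ih]

lemma lcMap_smul_id (r : R) : lcMap J n (r • (LinearMap.id : A →ₗ[R] A)) = r • LinearMap.id := by
  ext z
  exact localCohomology_map_smul_id (J := J) (n := n) (N := ModuleCat.of R A) r z

lemma lcMap_smul (r : R) (f : A →ₗ[R] B) : lcMap J n (r • f) = r • lcMap J n f := by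
  have : r • f = f ∘ₗ (r • LinearMap.id) := by ext; simp
  rw [this, lcMap_comp, lcMap_smul_id]
  ext; simp

variable {f : A →ₗ[R] B} {g : B →ₗ[R] C} {f' : A' →ₗ[R] B'} {g' : B' →ₗ[R] C'}

/-- The short complex in `ModuleCat R` attached to an exact pair of linear maps. -/
abbrev shortComplexOfExact (hfg : Function.Exact f g) : ShortComplex (ModuleCat.{u} R) :=
  ShortComplex.mk (ModuleCat.ofHom f) (ModuleCat.ofHom g)
    (ModuleCat.hom_ext hfg.linearMap_comp_eq_zero)

lemma shortComplexOfExact_shortExact (hfg : Function.Exact f g) (hf : Function.Injective f)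
    (hg : Function.Surjective g) : (shortComplexOfExact hfg).ShortExact :=
  ModuleCat.shortComplex_shortExact _ hfg hf hg

/-- The connecting map in local cohomology. -/
noncomputable def lcδ (hfg : Function.Exact f g) (hf : Function.Injective f)
    (hg : Function.Surjective g) : LC J n C →ₗ[R] LC J (n + 1) A :=
  localCohomologyδ J n (shortComplexOfExact_shortExact hfg hf hg)

variable (hfg : Function.Exact f g) (hf : Function.Injective f) (hg : Function.Surjective g)
  (hfg' : Function.Exact f' g') (hf' : Function.Injective f') (hg' : Function.Surjective g')

include hf hg hfg in
lemma lc_exact_middle : Function.Exact (lcMap J n f) (lcMap J n g) := by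
  intro z
  constructor
  · exact localCohomology_exact₂ (shortComplexOfExact_shortExact hfg hf hg) z
  · rintro ⟨w, rfl⟩
    rw [← lcMap_comp_apply, hfg.linearMap_comp_eq_zero, lcMap_zero, LinearMap.zero_apply]

lemma lc_exact_right : Function.Exact (lcMap J n g) (lcδ J n hfg hf hg) := by
  intro z
  constructor
  · exact localCohomology_exact₃ (shortComplexOfExact_shortExact hfg hf hg) z
  · rintro ⟨w, rfl⟩
    exact localCohomologyδ_map (shortComplexOfExact_shortExact hfg hf hg) w

lemma lc_exact_left : Function.Exact (lcδ J n hfg hf hg) (lcMap J (n + 1) f) := by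
  intro z
  constructor
  · exact localCohomology_exact₁ (shortComplexOfExact_shortExact hfg hf hg) z
  · rintro ⟨w, rfl⟩
    exact map_localCohomologyδ (shortComplexOfExact_shortExact hfg hf hg) w

lemma lcδ_naturality (a : A →ₗ[R] A') (b : B →ₗ[R] B') (c : C →ₗ[R] C')
    (hab : b ∘ₗ f = f' ∘ₗ a) (hbc : c ∘ₗ g = g' ∘ₗ b) (z : LC J n C) :
    lcMap J (n + 1) a (lcδ J n hfg hf hg z) = lcδ J n hfg' hf' hg' (lcMap J n c z) :=
  localCohomologyδ_naturality (shortComplexOfExact_shortExact hfg hf hg)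
    (shortComplexOfExact_shortExact hfg' hf' hg')
    { τ₁ := ModuleCat.ofHom a
      τ₂ := ModuleCat.ofHom b
      τ₃ := ModuleCat.ofHom c
      comm₁₂ := ModuleCat.hom_ext hab.symm
      comm₂₃ := ModuleCat.hom_ext hbc.symm } z

end ModuleLevel

/-! ### Degree zero: elements killed by a power of `J`. -/

section DegreeZero

variable {R : Type u} [CommRing R] {J : Ideal R} {A B : Type u} [AddCommGroup A] [AddCommGroup B]
  [Module R A] [Module R B]

/-- The class in degree zero local cohomology of a linear map from `R ⧸ J ^ t`. -/
noncomputable def lcZeroClass (J : Ideal R) {t : ℕ} (f : (R ⧸ J ^ t) →ₗ[R] A) : LC J 0 A :=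
  localCohomologyClass J 0 (ModuleCat.of R A) t (Abelian.Ext.mk₀ (ModuleCat.ofHom f))

lemma lcZeroClass_surjective (z : LC J 0 A) :
    ∃ (t : ℕ) (f : (R ⧸ J ^ t) →ₗ[R] A), lcZeroClass J f = z := by
  obtain ⟨t, α, rfl⟩ := exists_localCohomologyClass z
  obtain ⟨f, rfl⟩ := (Abelian.Ext.mk₀_bijective _ _).2 α
  exact ⟨t, f.hom, rfl⟩

lemma smul_lcZeroClass {t : ℕ} (r : R) (f : (R ⧸ J ^ t) →ₗ[R] A) :
    r • lcZeroClass J f = lcZeroClass J (r • f) := by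
  rw [lcZeroClass, ← localCohomologyClass_smul, ← Abelian.Ext.mk₀_smul]
  rfl

lemma lcMap_lcZeroClass {t : ℕ} (g : A →ₗ[R] B) (f : (R ⧸ J ^ t) →ₗ[R] A) :
    lcMap J 0 g (lcZeroClass J f) = lcZeroClass J (g ∘ₗ f) := by
  refine (map_localCohomologyClass (ModuleCat.ofHom g) _).trans ?_
  rw [Abelian.Ext.mk₀_comp_mk₀]
  rfl

lemma lcZeroClass_factor {t s : ℕ} (h : t ≤ s) (f : (R ⧸ J ^ t) →ₗ[R] A) :
    lcZeroClass J (f ∘ₗ Submodule.factor (Ideal.pow_le_pow_right h)) = lcZeroClass J f := by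
  rw [lcZeroClass, lcZeroClass, ← localCohomologyClass_quotPowMap h, Abelian.Ext.mk₀_comp_mk₀]
  rfl

lemma lcZeroClass_zero (t : ℕ) : lcZeroClass J (0 : (R ⧸ J ^ t) →ₗ[R] A) = 0 := by
  have : ModuleCat.ofHom (0 : (R ⧸ J ^ t) →ₗ[R] A) = 0 := rfl
  rw [lcZeroClass, this, Abelian.Ext.mk₀_zero, map_zero]

/-- The transition maps `R/J^s → R/J^t` are surjective, so the induced maps on `Hom` are injective
and nothing dies in the colimit. -/
lemma lcZeroClass_eq_zero_iff {t : ℕ} (f : (R ⧸ J ^ t) →ₗ[R] A) :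
    lcZeroClass J f = 0 ↔ f = 0 := by
  refine ⟨fun h ↦ ?_, by rintro rfl; exact lcZeroClass_zero t⟩
  obtain ⟨s, hs, h⟩ := (localCohomologyClass_eq_zero_iff _).1 h
  rw [Abelian.Ext.mk₀_comp_mk₀, Abelian.Ext.mk₀_eq_zero_iff] at h
  ext
  exact congr($h (Submodule.Quotient.mk 1))

/-- The linear map `R ⧸ J ^ t → A` sending `1` to an element killed by `J ^ t`. -/
noncomputable def quotPowLift {t : ℕ} (m : A) (hm : ∀ a ∈ J ^ t, a • m = 0) :
    (R ⧸ J ^ t) →ₗ[R] A :=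
  Submodule.liftQ _ (LinearMap.toSpanSingleton R A m) hm

lemma quotPowLift_mk_one {t : ℕ} (m : A) (hm : ∀ a ∈ J ^ t, a • m = 0) :
    quotPowLift m hm (Submodule.Quotient.mk 1) = m :=
  one_smul R m

lemma lc_zero_smul_eq_zero {k : ℕ}
    (h : ∀ (m : A) (t : ℕ), (∀ a ∈ J ^ t, a • m = 0) → ∀ a ∈ J ^ k, a • m = 0) :
    ∀ a ∈ J ^ k, ∀ z : LC J 0 A, a • z = 0 := by
  intro a ha z
  obtain ⟨t, f, rfl⟩ := lcZeroClass_surjective z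
  rw [smul_lcZeroClass, lcZeroClass_eq_zero_iff]
  ext
  refine h (f (Submodule.Quotient.mk 1)) t (fun b hb ↦ ?_) a ha
  rw [← map_smul, ← Submodule.Quotient.mk_smul, smul_eq_mul, mul_one,
    (Submodule.Quotient.mk_eq_zero _).2 hb, map_zero]

lemma smul_eq_zero_of_lc_zero {k : ℕ} (h : ∀ a ∈ J ^ k, ∀ z : LC J 0 A, a • z = 0)
    (m : A) (t : ℕ) (hm : ∀ a ∈ J ^ t, a • m = 0) : ∀ a ∈ J ^ k, a • m = 0 := by
  intro a ha
  have := h a ha (lcZeroClass J (quotPowLift m hm))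
  rw [smul_lcZeroClass, lcZeroClass_eq_zero_iff] at this
  have h1 : a • quotPowLift m hm (Submodule.Quotient.mk 1) = 0 :=
    congr($this (Submodule.Quotient.mk 1))
  rwa [quotPowLift_mk_one] at h1

/-- Every element is killed by a power of `J`. -/
def IsPowTorsion (J : Ideal R) (A : Type u) [AddCommGroup A] [Module R A] : Prop :=
  ∀ m : A, ∃ t : ℕ, ∀ a ∈ J ^ t, a • m = 0

lemma IsPowTorsion.of_injective (hB : IsPowTorsion J B) {f : A →ₗ[R] B}
    (hf : Function.Injective f) : IsPowTorsion J A := by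
  intro m
  obtain ⟨t, ht⟩ := hB (f m)
  exact ⟨t, fun a ha ↦ hf (by rw [map_smul, ht a ha, map_zero])⟩

lemma IsPowTorsion.of_surjective (hA : IsPowTorsion J A) {f : A →ₗ[R] B}
    (hf : Function.Surjective f) : IsPowTorsion J B := by
  intro m
  obtain ⟨m, rfl⟩ := hf m
  obtain ⟨t, ht⟩ := hA m
  exact ⟨t, fun a ha ↦ by rw [← map_smul, ht a ha, map_zero]⟩

/-- A preimage of the image of `1` is itself killed by a possibly higher power of `J`, and so
defines a class. -/
lemma lcMap_zero_surjective (hA : IsPowTorsion J A) {g : A →ₗ[R] B}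
    (hg : Function.Surjective g) : Function.Surjective (lcMap J 0 g) := by
  intro z
  obtain ⟨t, f, rfl⟩ := lcZeroClass_surjective z
  obtain ⟨m, hm⟩ := hg (f (Submodule.Quotient.mk 1))
  obtain ⟨s, hs⟩ := hA m
  have hs' : ∀ a ∈ J ^ max t s, a • m = 0 :=
    fun a ha ↦ hs a (Ideal.pow_le_pow_right (le_max_right _ _) ha)
  refine ⟨lcZeroClass J (quotPowLift m hs'), ?_⟩
  rw [← lcZeroClass_factor (le_max_left t s), lcMap_lcZeroClass]
  congr 1
  ext
  exact (congrArg g (quotPowLift_mk_one m hs')).trans hm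

end DegreeZero

/-! ### Vanishing of higher local cohomology of power-torsion modules. -/

section Vanishing

variable {R : Type u} [CommRing R] {J : Ideal R} {A : Type u} [AddCommGroup A] [Module R A]

lemma IsPowTorsion.exists_pow (hA : IsPowTorsion J A) [Module.Finite R A] :
    ∃ k : ℕ, ∀ a ∈ J ^ k, ∀ m : A, a • m = 0 := by
  classical
  obtain ⟨S, hS⟩ := Module.Finite.fg_top (R := R) (M := A)
  choose t ht using hA
  refine ⟨S.sup t, fun a ha m ↦ ?_⟩
  have hm : m ∈ Submodule.span R (S : Set A) := hS ▸ Submodule.mem_top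
  have : Submodule.span R (S : Set A) ≤ LinearMap.ker (LinearMap.lsmul R A a) := by
    rw [Submodule.span_le]
    intro x hx
    exact ht x a (Ideal.pow_le_pow_right (Finset.le_sup (f := t) hx) ha)
  exact this hm

/-- The submodule of the elements killed by a power of `J`. -/
def powTorsion (J : Ideal R) (A : Type u) [AddCommGroup A] [Module R A] : Submodule R A where
  carrier := {m | ∃ t : ℕ, ∀ a ∈ J ^ t, a • m = 0}
  zero_mem' := ⟨0, by simp⟩
  add_mem' := by
    rintro m m' ⟨t, ht⟩ ⟨t', ht'⟩
    refine ⟨max t t', fun a ha ↦ ?_⟩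
    rw [smul_add, ht a (Ideal.pow_le_pow_right (le_max_left _ _) ha),
      ht' a (Ideal.pow_le_pow_right (le_max_right _ _) ha), add_zero]
  smul_mem' := by
    rintro r m ⟨t, ht⟩
    exact ⟨t, fun a ha ↦ by rw [smul_comm, ht a ha, smul_zero]⟩

lemma isPowTorsion_powTorsion : IsPowTorsion J (powTorsion J A) := by
  rintro ⟨m, t, ht⟩
  exact ⟨t, fun a ha ↦ Subtype.ext (ht a ha)⟩

/-- Baer's criterion and Artin–Rees. The image of `g : K → powTorsion J A` is killed by some `J^k`,
and `K ∩ J^(k₀+k) ⊆ J^k K ⊆ ker g`. So `g` factors through a submodule of `R/J^(k₀+k)`, and an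
extension of it to `R/J^(k₀+k)` with values in `A` automatically has power-torsion values. -/
lemma powTorsion_injective [IsNoetherianRing R] [Module.Injective R A] :
    Module.Injective R (powTorsion J A) := by
  apply Module.Baer.injective
  intro K g
  have hK : Module.Finite R (LinearMap.range g) := inferInstance
  obtain ⟨k, hk⟩ := (isPowTorsion_powTorsion.of_injective
    (LinearMap.range g).injective_subtype).exists_pow (J := J)
  obtain ⟨k₀, hk₀⟩ := Ideal.exists_pow_inf_eq_pow_smul J (K : Submodule R R)
  have hAR := hk₀ (k₀ + k) (by lia)
  have hker : Submodule.comap K.subtype (J ^ (k₀ + k)) ≤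
      LinearMap.ker ((powTorsion J A).subtype ∘ₗ g) := by
    rintro ⟨x, hxK⟩ hx
    have hx' : x ∈ (J ^ (k₀ + k) • ⊤ ⊓ K : Submodule R R) := ⟨by simpa using hx, hxK⟩
    rw [hAR, Nat.add_sub_cancel_left] at hx'
    have hle : (J ^ k • (J ^ k₀ • ⊤ ⊓ K) : Submodule R R) ≤
        Submodule.map K.subtype (LinearMap.ker ((powTorsion J A).subtype ∘ₗ g)) := by
      rw [Submodule.smul_le]
      rintro r hr y ⟨-, hy⟩
      refine ⟨r • ⟨y, hy⟩, ?_, rfl⟩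
      have := congrArg Subtype.val (hk r hr ⟨g ⟨y, hy⟩, ⟨_, rfl⟩⟩)
      simp only [SetLike.mem_coe, LinearMap.mem_ker, map_smul]
      simpa using congrArg Subtype.val this
    obtain ⟨y, hy, hyx⟩ := hle hx'
    obtain rfl : y = ⟨x, hxK⟩ := Subtype.ext hyx
    exact hy
  obtain ⟨h, hh⟩ := Module.Injective.out (R := R) (Q := A)
    (Submodule.mapQ _ (J ^ (k₀ + k)) K.subtype le_rfl)
    (by
      rw [← LinearMap.ker_eq_bot, Submodule.ker_mapQ, Submodule.mkQ_map_self])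
    (Submodule.liftQ _ _ hker)
  refine ⟨LinearMap.codRestrict _ (h ∘ₗ Submodule.mkQ _) fun c ↦ ⟨k₀ + k, fun a ha ↦ ?_⟩,
    fun x hx ↦ Subtype.ext ?_⟩
  · rw [← map_smul]
    exact (congrArg h ((Submodule.Quotient.mk_eq_zero _).2 (Ideal.mul_mem_right _ _ ha))).trans
      (map_zero h)
  · exact hh (Submodule.Quotient.mk ⟨x, hx⟩)

lemma IsPowTorsion.exists_embedding_injective [IsNoetherianRing R] (hA : IsPowTorsion J A) :
    ∃ (E : Type u) (_ : AddCommGroup E) (_ : Module R E) (f : A →ₗ[R] E),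
      Function.Injective f ∧ Module.Injective R E ∧ IsPowTorsion J E := by
  let ι := Injective.ι (ModuleCat.of R A)
  let I : ModuleCat.{u} R := Injective.under (ModuleCat.of R A)
  have : Injective (ModuleCat.of R I) := Injective.injective_under (ModuleCat.of R A)
  have : Module.Injective R I :=
    Module.injective_module_of_injective_object _ _
  refine ⟨powTorsion J I, inferInstance, inferInstance,
    LinearMap.codRestrict _ ι.hom (fun m ↦ ?_), ?_, powTorsion_injective,
    isPowTorsion_powTorsion⟩
  · obtain ⟨t, ht⟩ := hA m
    exact ⟨t, fun a ha ↦ by rw [← map_smul, ht a ha, map_zero]⟩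
  · have := (ModuleCat.mono_iff_injective ι).1 inferInstance
    intro x y hxy
    exact this (congrArg Subtype.val hxy)

/-- Dimension shifting along an embedding into an injective module that is again power torsion. The
cokernel is power torsion too, and `lcMap_zero_surjective` settles the lowest degree. -/
theorem IsPowTorsion.lc_succ_eq_zero [IsNoetherianRing R] (hA : IsPowTorsion J A) (n : ℕ)
    (z : LC J (n + 1) A) : z = 0 := by
  induction n generalizing A with
  | zero =>
    obtain ⟨E, _, _, f, hf, hE, hEt⟩ := hA.exists_embedding_injective
    have hfg := f.exact_map_mkQ_range
    have hg := (LinearMap.range f).mkQ_surjective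
    have := Module.injective_object_of_injective_module R E
    obtain ⟨w, rfl⟩ := (lc_exact_left J 0 hfg hf hg z).1
      (localCohomology_succ_eq_zero_of_injective (N := ModuleCat.of R E) _)
    exact (lc_exact_right J 0 hfg hf hg w).2 (lcMap_zero_surjective hEt hg w)
  | succ n ih =>
    obtain ⟨E, _, _, f, hf, hE, hEt⟩ := hA.exists_embedding_injective
    have hfg := f.exact_map_mkQ_range
    have hg := (LinearMap.range f).mkQ_surjective
    have := Module.injective_object_of_injective_module R E
    obtain ⟨w, rfl⟩ := (lc_exact_left J (n + 1) hfg hf hg z).1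
      (localCohomology_succ_eq_zero_of_injective (N := ModuleCat.of R E) _)
    rw [ih (hEt.of_surjective hg) w, map_zero]

end Vanishing

/-! ### Annihilators of local cohomology along exact sequences. -/

section Annihilation

variable {R : Type u} [CommRing R] {J : Ideal R}
  {A B C : Type u} [AddCommGroup A] [AddCommGroup B] [AddCommGroup C]
  [Module R A] [Module R B] [Module R C]

/-- `I` annihilates `A`. -/
def KilledBy (I : Ideal R) (A : Type*) [AddCommGroup A] [Module R A] : Prop :=
  ∀ a ∈ I, ∀ z : A, a • z = 0

lemma KilledBy.of_surjective {I : Ideal R} {A B : Type*} [AddCommGroup A] [Module R A]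
    [AddCommGroup B] [Module R B] (h : KilledBy I A) {f : A →ₗ[R] B}
    (hf : Function.Surjective f) : KilledBy I B := by
  intro a ha z
  obtain ⟨z, rfl⟩ := hf z
  rw [← map_smul, h a ha, map_zero]

lemma KilledBy.of_injective {I : Ideal R} {A B : Type*} [AddCommGroup A] [Module R A]
    [AddCommGroup B] [Module R B] (h : KilledBy I B) {f : A →ₗ[R] B}
    (hf : Function.Injective f) : KilledBy I A := by
  intro a ha z
  exact hf (by rw [map_smul, h a ha, map_zero])

lemma KilledBy.of_exact {I K : Ideal R} {A B C : Type*} [AddCommGroup A] [Module R A]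
    [AddCommGroup B] [Module R B] [AddCommGroup C] [Module R C] (hA : KilledBy I A)
    (hC : KilledBy K C) {f : A →ₗ[R] B} {g : B →ₗ[R] C} (hfg : Function.Exact f g) :
    KilledBy (I * K) B := by
  intro a ha z
  induction ha using Submodule.mul_induction_on' with
  | mem_mul_mem u hu v hv =>
    obtain ⟨w, hw⟩ := (hfg (v • z)).1 (by rw [map_smul, hC v hv])
    rw [mul_smul, ← hw, ← map_smul, hA u hu, map_zero]
  | add a _ b _ h1 h2 => rw [add_smul, h1, h2, add_zero]

lemma killedBy_lc_zero_iff {k : ℕ} :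
    KilledBy (J ^ k) (LC J 0 A) ↔ KilledBy (J ^ k) (powTorsion J A) := by
  constructor
  · rintro h a ha ⟨m, t, ht⟩
    exact Subtype.ext (smul_eq_zero_of_lc_zero h m t ht a ha)
  · intro h a ha z
    refine lc_zero_smul_eq_zero (fun m t hm a ha ↦ ?_) a ha z
    exact congrArg Subtype.val (h a ha ⟨m, t, hm⟩)

lemma lc_zero_eq_zero (h : powTorsion J A = ⊥) (z : LC J 0 A) : z = 0 := by
  -- Exponent `0` makes the ideal the unit ideal, so being killed by it means being zero.
  have : KilledBy (J ^ 0) (LC J 0 A) := by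
    rw [killedBy_lc_zero_iff, h]
    intro a _ z
    exact Subsingleton.elim _ _
  simpa using this 1 (by simp) z

lemma exists_killedBy_powTorsion [IsNoetherianRing R] [Module.Finite R A] :
    ∃ k : ℕ, KilledBy (J ^ k) (powTorsion J A) :=
  isPowTorsion_powTorsion.exists_pow

lemma powTorsion_quotient_powTorsion [IsNoetherianRing R] [Module.Finite R A] :
    powTorsion J (A ⧸ powTorsion J A) = ⊥ := by
  rw [eq_bot_iff]
  intro m hm
  obtain ⟨m, rfl⟩ := Submodule.mkQ_surjective _ m
  obtain ⟨t, ht⟩ := hm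
  obtain ⟨k, hk⟩ := exists_killedBy_powTorsion (J := J) (A := A)
  rw [Submodule.mem_bot, Submodule.mkQ_apply, Submodule.Quotient.mk_eq_zero]
  refine ⟨k + t, fun a ha ↦ ?_⟩
  rw [pow_add] at ha
  induction ha using Submodule.mul_induction_on' with
  | mem_mul_mem u hu v hv =>
    have h1 := ht v hv
    rw [← map_smul, Submodule.mkQ_apply, Submodule.Quotient.mk_eq_zero] at h1
    rw [mul_smul]
    exact congrArg Subtype.val (hk u hu ⟨_, h1⟩)
  | add a _ b _ h1 h2 => rw [add_smul, h1, h2, add_zero]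

lemma lcMap_mkQ_surjective [IsNoetherianRing R] {U : Submodule R A} (hU : IsPowTorsion J U)
    (n : ℕ) : Function.Surjective (lcMap J n U.mkQ) := by
  intro z
  refine (lc_exact_right J n (LinearMap.exact_subtype_mkQ U) U.injective_subtype
    U.mkQ_surjective z).1 ?_
  exact hU.lc_succ_eq_zero _ _

lemma lcMap_mkQ_injective [IsNoetherianRing R] {U : Submodule R A} (hU : IsPowTorsion J U)
    (n : ℕ) : Function.Injective (lcMap J (n + 1) U.mkQ) := by
  rw [injective_iff_map_eq_zero]
  intro z hz
  obtain ⟨w, rfl⟩ := (lc_exact_middle J (n + 1) (LinearMap.exact_subtype_mkQ U) U.injective_subtype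
    U.mkQ_surjective z).1 hz
  rw [hU.lc_succ_eq_zero n w, map_zero]

open scoped Pointwise

lemma exact_smul_quotSMulTop (x : R) :
    Function.Exact (LinearMap.lsmul R A x) (x • (⊤ : Submodule R A)).mkQ := by
  rw [LinearMap.exact_iff, Submodule.ker_mkQ]
  ext m
  simp [Submodule.mem_smul_pointwise_iff_exists]

lemma KilledBy.quotSMulTop {x : R} (hx : IsSMulRegular A x) {n k : ℕ}
    (h : KilledBy (J ^ k) (LC J n A)) (h' : KilledBy (J ^ k) (LC J (n + 1) A)) :
    KilledBy (J ^ (k + k)) (LC J n (QuotSMulTop x A)) := by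
  rw [pow_add]
  exact h.of_exact h' (lc_exact_right J n (exact_smul_quotSMulTop x) hx
    (Submodule.mkQ_surjective _))

end Annihilation

/-! ### Saturation of a submodule with respect to a regular element. -/

section Saturation

variable {R : Type*} [CommRing R] [IsNoetherianRing R]
  {N : Type*} [AddCommGroup N] [Module R N] [Module.Finite R N]

/-- The saturation of a submodule with respect to an element of the ring. -/
def Submodule.powSaturation (y : R) (L : Submodule R N) : Submodule R N where
  carrier := {m | ∃ j : ℕ, y ^ j • m ∈ L}
  zero_mem' := ⟨0, by simp⟩
  add_mem' := by
    rintro m m' ⟨j, hj⟩ ⟨j', hj'⟩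
    refine ⟨j + j', ?_⟩
    rw [smul_add]
    refine L.add_mem ?_ ?_
    · rw [add_comm, pow_add, mul_smul]
      exact L.smul_mem _ hj
    · rw [pow_add, mul_smul]
      exact L.smul_mem _ hj'
  smul_mem' := by
    rintro r m ⟨j, hj⟩
    exact ⟨j, by rw [smul_comm]; exact L.smul_mem _ hj⟩

/-- The saturation is finitely generated, so a single power of `y` carries it into `L`, injectively
because `y` is regular. -/
lemma supportDim_powSaturation_le {y : R} (hreg : IsSMulRegular N y) (L : Submodule R N) :
    Module.supportDim R (L.powSaturation y) ≤ Module.supportDim R L := by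
  classical
  obtain ⟨S, hS⟩ := Module.Finite.fg_top (R := R) (M := L.powSaturation y)
  choose t ht using fun m : L.powSaturation y ↦ m.2
  have hle : ∀ m : L.powSaturation y, y ^ S.sup t • (m : N) ∈ L := by
    intro m
    have hm : m ∈ Submodule.span R (S : Set (L.powSaturation y)) := hS ▸ Submodule.mem_top
    have : Submodule.span R (S : Set (L.powSaturation y)) ≤
        L.comap (LinearMap.lsmul R N (y ^ S.sup t) ∘ₗ (L.powSaturation y).subtype) := by
      rw [Submodule.span_le]
      intro x hx
      obtain ⟨c, hc⟩ := pow_dvd_pow y (Finset.le_sup (f := t) hx)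
      change y ^ S.sup t • (x : N) ∈ L
      rw [hc, mul_comm, mul_smul]
      exact L.smul_mem _ (ht x)
    exact this hm
  refine Module.supportDim_le_of_injective (LinearMap.codRestrict L
    (LinearMap.lsmul R N (y ^ S.sup t) ∘ₗ (L.powSaturation y).subtype) hle) ?_
  intro a b hab
  exact Subtype.ext (hreg.pow _ (congrArg Subtype.val hab))

end Saturation

/-! ### A lower bound for the dimension of submodules that are not power torsion. -/

section Dimension

open scoped Pointwise in
lemma quotSMulTop_map_subtype_injective {R : Type*} [CommRing R] {N : Type*} [AddCommGroup N]
    [Module R N] {y : R} {L : Submodule R N} (hL : ∀ m, y • m ∈ L → m ∈ L) :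
    Function.Injective (QuotSMulTop.map y L.subtype) := by
  rw [injective_iff_map_eq_zero]
  intro m hm
  obtain ⟨l, rfl⟩ := Submodule.mkQ_surjective _ m
  rw [Submodule.mkQ_apply, QuotSMulTop.map_apply_mk, Submodule.Quotient.mk_eq_zero,
    Submodule.mem_smul_pointwise_iff_exists] at hm
  obtain ⟨m, -, hm⟩ := hm
  rw [Submodule.mkQ_apply, Submodule.Quotient.mk_eq_zero, Submodule.mem_smul_pointwise_iff_exists]
  exact ⟨⟨m, hL m (hm ▸ l.2)⟩, Submodule.mem_top, Subtype.ext hm⟩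

lemma zero_le_supportDim (R : Type*) [CommRing R] (A : Type*) [AddCommGroup A] [Module R A]
    [Nontrivial A] : (0 : WithBot ℕ∞) ≤ Module.supportDim R A := by
  have := Module.nonempty_support_of_nontrivial (R := R) (M := A)
  rw [← Set.nonempty_coe_sort] at this
  exact Order.krullDim_nonneg

variable {R : Type u} [CommRing R] [IsLocalRing R] [IsNoetherianRing R]
  {N : Type u} [AddCommGroup N] [Module R N] [Module.Finite R N]

open scoped Pointwise

/-- Otherwise prime avoidance puts the maximal ideal inside an associated prime, whose witness is
then a nonzero element killed by the maximal ideal. -/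
lemma exists_isSMulRegular (h : powTorsion (maximalIdeal R) N = ⊥) :
    ∃ y ∈ maximalIdeal R, IsSMulRegular N y := by
  cases subsingleton_or_nontrivial N
  · exact ⟨0, zero_mem _, IsSMulRegular.zero⟩
  by_contra! hy
  obtain ⟨p₀, hp₀⟩ := associatedPrimes.nonempty R N
  obtain ⟨p, hp, hle⟩ := (Ideal.subset_union_prime_finite (associatedPrimes.finite R N) p₀ p₀
    (fun I hI _ _ ↦ IsAssociatedPrime.isPrime hI) (I := maximalIdeal R)).1
    (by rw [biUnion_associatedPrimes_eq_compl_regular R N]; exact fun r hr ↦ hy r hr)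
  obtain ⟨hprime, m, hm⟩ := isAssociatedPrime_iff.1 (AssociatedPrimes.mem_iff.1 hp)
  have hmem : m ∈ powTorsion (maximalIdeal R) N := by
    refine ⟨1, fun a ha ↦ ?_⟩
    rw [pow_one] at ha
    have := hle ha
    rw [hm] at this
    simpa [Submodule.mem_colon_singleton] using this
  rw [h, Submodule.mem_bot] at hmem
  apply hprime.ne_top
  rw [hm, hmem, Ideal.eq_top_iff_one, Submodule.mem_colon_singleton]
  simp

/-- The sequence `H⁰(N/L) → H¹(L) → H¹(N)` shows that a power `𝔪^q` kills `H¹(L)`. If `L/yL` were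
power torsion, so would be `L/y^(q+1)L`, which then embeds in `H¹(L)` because `H⁰(L) = 0`. So `y^q L
⊆ y^(q+1) L`, hence `L = yL` by regularity, contradicting Nakayama. -/
lemma not_isPowTorsion_quotSMulTop {k : ℕ} {y : R} (hy : y ∈ maximalIdeal R) {L : Submodule R N}
    (hL : L ≠ ⊥) (hreg : IsSMulRegular N y) (hN : powTorsion (maximalIdeal R) N = ⊥)
    (h : KilledBy (maximalIdeal R ^ k) (LC (maximalIdeal R) 1 N)) :
    ¬ IsPowTorsion (maximalIdeal R) (QuotSMulTop y L) := by
  intro htor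
  have hregL : IsSMulRegular L y := hreg.submodule L y
  have hLtor : powTorsion (maximalIdeal R) L = ⊥ := by
    rw [eq_bot_iff]
    rintro ⟨m, hm⟩ ⟨t, ht⟩
    have : m ∈ powTorsion (maximalIdeal R) N := ⟨t, fun a ha ↦ congrArg Subtype.val (ht a ha)⟩
    rw [hN, Submodule.mem_bot] at this
    simpa using this
  obtain ⟨k₁, hk₁⟩ := exists_killedBy_powTorsion (J := maximalIdeal R) (A := N ⧸ L)
  rw [← killedBy_lc_zero_iff] at hk₁
  have hL1 := hk₁.of_exact h (lc_exact_left (maximalIdeal R) 0 (LinearMap.exact_subtype_mkQ L)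
    L.injective_subtype L.mkQ_surjective)
  rw [← pow_add] at hL1
  obtain ⟨t, ht⟩ := htor.exists_pow
  have ht' : ∀ a ∈ maximalIdeal R ^ t, ∀ l : L, ∃ l' : L, a • l = y • l' := by
    intro a ha l
    have h1 := ht a ha (Submodule.Quotient.mk l)
    rw [← Submodule.Quotient.mk_smul, Submodule.Quotient.mk_eq_zero,
      Submodule.mem_smul_pointwise_iff_exists] at h1
    obtain ⟨l', -, hl'⟩ := h1
    exact ⟨l', hl'.symm⟩
  have hpow : ∀ j : ℕ, ∀ a ∈ maximalIdeal R ^ (t * j), ∀ l : L, ∃ l' : L, a • l = y ^ j • l' := by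
    intro j
    induction j with
    | zero => exact fun a _ l ↦ ⟨a • l, by simp⟩
    | succ j ih =>
      intro a ha l
      rw [mul_add, mul_one, pow_add] at ha
      induction ha using Submodule.mul_induction_on' with
      | mem_mul_mem u hu v hv =>
        obtain ⟨l₁, h₁⟩ := ht' v hv l
        obtain ⟨l₂, h₂⟩ := ih u hu l₁
        exact ⟨l₂, by rw [mul_smul, h₁, smul_comm, h₂, smul_smul, pow_succ']⟩
      | add a _ b _ h1 h2 =>
        obtain ⟨l₁, h₁⟩ := h1
        obtain ⟨l₂, h₂⟩ := h2
        exact ⟨l₁ + l₂, by rw [add_smul, h₁, h₂, smul_add]⟩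
  set q := k₁ + k
  have hQ : IsPowTorsion (maximalIdeal R) (QuotSMulTop (y ^ (q + 1)) L) := by
    intro m
    obtain ⟨l, rfl⟩ := Submodule.mkQ_surjective _ m
    refine ⟨t * (q + 1), fun a ha ↦ ?_⟩
    obtain ⟨l', hl'⟩ := hpow (q + 1) a ha l
    rw [← map_smul, hl', Submodule.mkQ_apply, Submodule.Quotient.mk_eq_zero]
    exact Submodule.smul_mem_pointwise_smul _ _ _ Submodule.mem_top
  have hinj : Function.Injective (lcδ (maximalIdeal R) 0 (exact_smul_quotSMulTop (y ^ (q + 1)))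
      (hregL.pow (q + 1)) (Submodule.mkQ_surjective _)) := by
    rw [injective_iff_map_eq_zero]
    intro z hz
    obtain ⟨w, rfl⟩ := (lc_exact_right (maximalIdeal R) 0 (exact_smul_quotSMulTop (y ^ (q + 1)))
      (hregL.pow (q + 1)) (Submodule.mkQ_surjective _) z).1 hz
    rw [lc_zero_eq_zero hLtor w, map_zero]
  have hk := killedBy_lc_zero_iff.1 (hL1.of_injective hinj)
  obtain ⟨l, hl, hl0⟩ := Submodule.exists_mem_ne_zero_of_ne_bot hL
  have : Nontrivial L := ⟨⟨l, hl⟩, 0, by simpa using hl0⟩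
  have := nontrivial_quotSMulTop_of_mem_maximalIdeal L hy
  obtain ⟨m, hm⟩ := exists_ne (0 : QuotSMulTop y L)
  obtain ⟨l, rfl⟩ := Submodule.mkQ_surjective _ m
  apply hm
  have h1 := congrArg Subtype.val (hk (y ^ q) (Ideal.pow_mem_pow hy q) ⟨Submodule.Quotient.mk l, hQ _⟩)
  have h2 : y ^ q • (Submodule.Quotient.mk l : QuotSMulTop (y ^ (q + 1)) L) = 0 := h1
  rw [← Submodule.Quotient.mk_smul, Submodule.Quotient.mk_eq_zero,
    Submodule.mem_smul_pointwise_iff_exists] at h2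
  obtain ⟨l', -, hl'⟩ := h2
  rw [pow_succ, mul_smul] at hl'
  rw [Submodule.mkQ_apply, Submodule.Quotient.mk_eq_zero, ← hregL.pow q hl']
  exact Submodule.smul_mem_pointwise_smul _ _ _ Submodule.mem_top

/-- Induction on `d`: divide out the power torsion of `N`, then a regular element `y`. Replacing `L`
by its `y`-saturation does not raise its dimension and makes `L/yL` a submodule of `N/yN`, to which
the induction hypothesis applies. The annihilating exponent doubles at each step, which is why `k`
is generalized. -/
theorem natCast_le_supportDim_of_not_isPowTorsion (d : ℕ) {k : ℕ}
    (hk : ∀ i < d, KilledBy (maximalIdeal R ^ k) (LC (maximalIdeal R) i N))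
    (L : Submodule R N) (hL : ¬ IsPowTorsion (maximalIdeal R) L) :
    (d : WithBot ℕ∞) ≤ Module.supportDim R L := by
  induction d generalizing N k with
  | zero =>
    have : Nontrivial L := by
      by_contra h
      rw [not_nontrivial_iff_subsingleton] at h
      exact hL fun m ↦ ⟨0, fun a _ ↦ Subsingleton.elim _ _⟩
    exact zero_le_supportDim R L
  | succ d ih =>
    set U := powTorsion (maximalIdeal R) N with hUdef
    have hU : IsPowTorsion (maximalIdeal R) U := isPowTorsion_powTorsion
    have hN : powTorsion (maximalIdeal R) (N ⧸ U) = ⊥ := powTorsion_quotient_powTorsion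
    have hkN : ∀ i < d + 1, KilledBy (maximalIdeal R ^ k) (LC (maximalIdeal R) i (N ⧸ U)) :=
      fun i hi ↦ (hk i hi).of_surjective (lcMap_mkQ_surjective hU i)
    obtain ⟨y, hy, hreg⟩ := exists_isSMulRegular hN
    set L₁ := L.map U.mkQ
    set L₂ := L₁.powSaturation y
    have h1 : Module.supportDim R L₁ ≤ Module.supportDim R L :=
      Module.supportDim_le_of_surjective _ (U.mkQ.submoduleMap_surjective L)
    have h2 : Module.supportDim R L₂ ≤ Module.supportDim R L₁ := supportDim_powSaturation_le hreg L₁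
    have hL₁ : L₁ ≠ ⊥ := by
      intro h0
      refine hL (hU.of_injective (f := Submodule.inclusion ?_) (Submodule.inclusion_injective _))
      rw [← U.ker_mkQ, LinearMap.le_ker_iff_map]
      exact h0
    have hle : L₁ ≤ L₂ := fun m hm ↦ ⟨0, by simpa using hm⟩
    have hL₂ : L₂ ≠ ⊥ := fun h0 ↦ hL₁ (eq_bot_iff.2 (h0 ▸ hle))
    have hsat : ∀ m, y • m ∈ L₂ → m ∈ L₂ := by
      rintro m ⟨j, hj⟩
      exact ⟨j + 1, by rwa [pow_succ, mul_smul]⟩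
    refine le_trans ?_ (h2.trans h1)
    rw [← Module.supportDim_quotSMulTop_succ_eq_supportDim (hreg.submodule L₂ y) hy]
    push_cast
    gcongr
    obtain ⟨l, hl, hl0⟩ := Submodule.exists_mem_ne_zero_of_ne_bot hL₂
    have : Nontrivial L₂ := ⟨⟨l, hl⟩, 0, by simpa using hl0⟩
    have := nontrivial_quotSMulTop_of_mem_maximalIdeal L₂ hy
    -- When `d = 0` nothing is assumed about `H¹`, but only nonnegativity of the dimension is
    -- needed.
    rcases Nat.eq_zero_or_pos d with rfl | hd
    · exact zero_le_supportDim R _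
    have hinj := quotSMulTop_map_subtype_injective hsat
    rw [Module.supportDim_eq_of_equiv (LinearEquiv.ofInjective _ hinj)]
    refine ih (fun i hi ↦ (hkN i (by lia)).quotSMulTop hreg (hkN (i + 1) (by lia))) _ ?_
    intro htor
    exact not_isPowTorsion_quotSMulTop hy hL₂ hreg hN (hkN 1 (by lia))
      (htor.of_injective (LinearEquiv.ofInjective _ hinj).injective)

end Dimension

/-! ### Splitting an exact sequence over the part of its last term killed by an ideal. -/

section LinearAlgebra

variable {R : Type*} [CommRing R]

lemma Ideal.exists_sum_of_mem_mul {I K : Ideal R} {x : R} (hx : x ∈ I * K) :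
    ∃ (ι : Type) (_ : Fintype ι) (a b : ι → R),
      (∀ j, a j ∈ I) ∧ (∀ j, b j ∈ K) ∧ x = ∑ j, a j * b j := by
  induction hx using Submodule.mul_induction_on' with
  | mem_mul_mem u hu v hv =>
    exact ⟨Unit, inferInstance, fun _ ↦ u, fun _ ↦ v, fun _ ↦ hu, fun _ ↦ hv, by simp⟩
  | add x _ y _ hx hy =>
    obtain ⟨ι, _, a, b, ha, hb, rfl⟩ := hx
    obtain ⟨ι', _, a', b', ha', hb', rfl⟩ := hy
    refine ⟨ι ⊕ ι', inferInstance, Sum.elim a a', Sum.elim b b', ?_, ?_, by simp⟩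
    · rintro (j | j) <;> simp [ha, ha']
    · rintro (j | j) <;> simp [hb, hb']

variable {A B C : Type*} [AddCommGroup A] [AddCommGroup B] [AddCommGroup C] [Module R A]
  [Module R B] [Module R C]

lemma LinearMap.exists_factor_range {p : A →ₗ[R] B} {q : A →ₗ[R] C}
    (h : LinearMap.ker p ≤ LinearMap.ker q) :
    ∃ s : LinearMap.range p →ₗ[R] C, ∀ v, s ⟨p v, v, rfl⟩ = q v := by
  refine ⟨(LinearMap.ker p).liftQ q h ∘ₗ p.quotKerEquivRange.symm.toLinearMap, fun v ↦ ?_⟩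
  have : p.quotKerEquivRange.symm ⟨p v, v, rfl⟩ = Submodule.Quotient.mk v := by
    rw [LinearEquiv.symm_apply_eq]
    rfl
  rw [LinearMap.comp_apply, LinearEquiv.coe_coe, this]
  rfl

variable {I : Ideal R} {f : A →ₗ[R] B} {g : B →ₗ[R] C}
  {s : Submodule.torsionBySet R C (I : Set R) →ₗ[R] B}

lemma mem_torsionBySet_ideal {c : C} :
    c ∈ Submodule.torsionBySet R C (I : Set R) ↔ ∀ a ∈ I, a • c = 0 := by
  simp [Submodule.mem_torsionBySet_iff]

lemma coprod_section_injective (hf : Function.Injective f) (hfg : Function.Exact f g)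
    (hs : ∀ t, g (s t) = t) : Function.Injective (f.coprod s) := by
  rw [injective_iff_map_eq_zero]
  rintro ⟨a, t⟩ h
  rw [LinearMap.coprod_apply] at h
  have ht : t = 0 := by
    apply Subtype.ext
    rw [← hs t]
    simpa [hfg.apply_apply_eq_zero] using congrArg g h
  rw [ht, map_zero, add_zero] at h
  exact Prod.ext (hf (h.trans (map_zero f).symm)) ht

lemma mem_range_coprod_section (hfg : Function.Exact f g) (hs : ∀ t, g (s t) = t) {b : B}
    (hb : g b ∈ Submodule.torsionBySet R C (I : Set R)) : b ∈ LinearMap.range (f.coprod s) := by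
  obtain ⟨a, ha⟩ := (hfg (b - s ⟨g b, hb⟩)).1 (by rw [map_sub, hs, sub_self])
  exact ⟨(a, ⟨g b, hb⟩), by rw [LinearMap.coprod_apply, ha, sub_add_cancel]⟩

/-- The range of `f.coprod s` is exactly the part of `B` killed by `I`: it is killed since `I` kills
both summands, and `g` sends elements killed by `I` to the domain of `s`. -/
lemma nonempty_torsionBySet_equiv_prod (hf : Function.Injective f) (hfg : Function.Exact f g)
    (hs : ∀ t, g (s t) = t) (hA : KilledBy I A) :
    Nonempty (Submodule.torsionBySet R B (I : Set R) ≃ₗ[R]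
      A × Submodule.torsionBySet R C (I : Set R)) := by
  have h : LinearMap.range (f.coprod s) = Submodule.torsionBySet R B (I : Set R) := by
    apply le_antisymm
    · rintro _ ⟨⟨a, t⟩, rfl⟩
      rw [mem_torsionBySet_ideal]
      intro r hr
      have ht : r • t = 0 := Subtype.ext (mem_torsionBySet_ideal.1 t.2 r hr)
      rw [← map_smul, Prod.smul_mk, hA r hr, ht]
      exact map_zero _
    · intro b hb
      refine mem_range_coprod_section hfg hs (mem_torsionBySet_ideal.2 fun r hr ↦ ?_)
      rw [← map_smul, mem_torsionBySet_ideal.1 hb r hr, map_zero]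
  exact ⟨((LinearEquiv.ofInjective _ (coprod_section_injective hf hfg hs)).trans
    (LinearEquiv.ofEq _ _ h)).symm⟩

lemma nonempty_equiv_prod (hf : Function.Injective f) (hfg : Function.Exact f g)
    (hs : ∀ t, g (s t) = t) (hC : KilledBy I C) : Nonempty (B ≃ₗ[R] A × C) := by
  have h : Submodule.torsionBySet R C (I : Set R) = ⊤ :=
    eq_top_iff.2 fun c _ ↦ mem_torsionBySet_ideal.2 fun r hr ↦ hC r hr c
  have hsurj : Function.Surjective (f.coprod s) := fun b ↦
    mem_range_coprod_section hfg hs (h ▸ Submodule.mem_top)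
  exact ⟨(LinearEquiv.ofBijective _ ⟨coprod_section_injective hf hfg hs, hsurj⟩).symm.trans
    ((LinearEquiv.refl R A).prodCongr ((LinearEquiv.ofEq _ _ h).trans Submodule.topEquiv))⟩

end LinearAlgebra

/-! ### The section of the connecting map. -/

section Splitting

variable {R : Type u} [CommRing R] [IsNoetherianRing R] {J I : Ideal R}
  {M : Type u} [AddCommGroup M] [Module R M]

open scoped Pointwise

/-- Multiplication by `x` on `M/U` factors through `M^r`, and the section comes from comparing the
long exact sequences of `β` and of `φ = α ∘ β`. -/
theorem exists_section_lc_quotSMulTop {U : Submodule R M} (hU : IsPowTorsion J U)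
    (hIU : KilledBy I U) {x : R} (hx : x ∈ I * I) (hxU : ∀ m : M, x • m = 0 → m ∈ U)
    (i : ℕ) (hi : KilledBy I (LC J i M)) :
    ∃ (f : LC J i M →ₗ[R] LC J i (QuotSMulTop x M))
      (g : LC J i (QuotSMulTop x M) →ₗ[R] LC J (i + 1) M)
      (s : Submodule.torsionBySet R (LC J (i + 1) M) (I : Set R) →ₗ[R] LC J i (QuotSMulTop x M)),
      Function.Injective f ∧ Function.Exact f g ∧ ∀ t, g (s t) = t := by
  classical
  have hxI : x ∈ I := Ideal.mul_le_left hx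
  obtain ⟨ι, _, a, b, ha, hb, hab⟩ := Ideal.exists_sum_of_mem_mul hx
  let e : LC J (i + 1) M ≃ₗ[R] LC J (i + 1) (M ⧸ U) :=
    LinearEquiv.ofBijective _ ⟨lcMap_mkQ_injective hU i, lcMap_mkQ_surjective hU (i + 1)⟩
  let φ : (M ⧸ U) →ₗ[R] M := U.liftQ (LinearMap.lsmul R M x) fun m hm ↦
    congrArg Subtype.val (hIU x hxI ⟨m, hm⟩)
  let q : M →ₗ[R] QuotSMulTop x M := (x • (⊤ : Submodule R M)).mkQ
  let β₀ : M →ₗ[R] (ι → M) := LinearMap.pi fun j ↦ b j • LinearMap.id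
  let β : (M ⧸ U) →ₗ[R] (ι → M) := U.liftQ β₀ fun m hm ↦
    funext fun j ↦ congrArg Subtype.val (hIU (b j) (hb j) ⟨m, hm⟩)
  let α : (ι → M) →ₗ[R] M := ∑ j, a j • LinearMap.proj j
  have hαβ : α ∘ₗ β = φ := by
    refine Submodule.linearMap_qext _ (LinearMap.ext fun m ↦ ?_)
    change α (β₀ m) = x • m
    simp [α, β₀, hab, Finset.sum_smul, mul_smul]
  have hφ : Function.Injective φ := by
    rw [injective_iff_map_eq_zero]
    intro m hm
    obtain ⟨m, rfl⟩ := U.mkQ_surjective m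
    exact (Submodule.Quotient.mk_eq_zero _).2 (hxU m hm)
  have hφq : Function.Exact φ q := by
    rw [LinearMap.exact_iff, show φ.range = _ from Submodule.range_liftQ _ _ _,
      ← LinearMap.exact_iff]
    exact exact_smul_quotSMulTop x
  have hq : Function.Surjective q := Submodule.mkQ_surjective _
  have hβ : Function.Injective β := by
    have : Function.Injective (α ∘ₗ β) := hαβ ▸ hφ
    exact Function.Injective.of_comp this
  have hβq := β.exact_map_mkQ_range
  have hq' := (LinearMap.range β).mkQ_surjective
  -- The map of cokernels induced by `α`; with the identity on `M ⧸ U` it completes a morphism of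
  -- short exact sequences.
  let c : ((ι → M) ⧸ LinearMap.range β) →ₗ[R] QuotSMulTop x M :=
    (LinearMap.range β).liftQ (q ∘ₗ α) (by
      rintro _ ⟨m, rfl⟩
      rw [LinearMap.mem_ker, LinearMap.comp_apply, ← LinearMap.comp_apply α, hαβ]
      exact hφq.apply_apply_eq_zero m)
  have hc : c ∘ₗ (LinearMap.range β).mkQ = q ∘ₗ α := Submodule.liftQ_mkQ _ _ _
  let δ := lcδ J i hφq hφ hq
  let δ' := lcδ J i hβq hβ hq'
  have hδ : ∀ v, δ (lcMap J i c v) = δ' v := by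
    intro v
    have := lcδ_naturality J i hβq hβ hq' hφq hφ hq LinearMap.id α c hαβ hc v
    rw [lcMap_id] at this
    exact this.symm
  have hlcα : lcMap J i α = 0 := by
    ext z
    simp only [α, lcMap_sum, lcMap_smul, LinearMap.sum_apply, LinearMap.smul_apply,
      LinearMap.zero_apply]
    exact Finset.sum_eq_zero fun j _ ↦ hi _ (ha j) _
  have hlcφ : lcMap J i φ = 0 := by
    rw [← hαβ, lcMap_comp, hlcα, LinearMap.zero_comp]
  -- The kernel of `δ'` comes from `H^i(M^r)`, on which `c` acts through `α`, hence by zero. So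
  -- lifting along `δ'` and then applying `c` is well defined on the range of `δ'`.
  obtain ⟨s, hs⟩ := LinearMap.exists_factor_range (p := δ') (q := lcMap J i c) (by
    intro v hv
    obtain ⟨w, rfl⟩ := (lc_exact_right J i hβq hβ hq' v).1 hv
    rw [LinearMap.mem_ker, ← lcMap_comp_apply, hc, lcMap_comp_apply, hlcα, LinearMap.zero_apply,
      map_zero])
  -- The range of `δ'` is the kernel of `H^{i+1}(β)`, whose components are multiplications by the
  -- `b_j ∈ I` after identifying along `e`.
  have hrange : ∀ t : Submodule.torsionBySet R (LC J (i + 1) M) (I : Set R),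
      e t ∈ LinearMap.range δ' := by
    intro t
    refine (lc_exact_left J i hβq hβ hq' _).1 ?_
    have h1 : β₀ = ∑ j, b j • LinearMap.single R (fun _ ↦ M) j := by
      ext m j
      simp [β₀, Finset.sum_apply, Pi.single_apply]
    change lcMap J (i + 1) β (lcMap J (i + 1) U.mkQ t) = 0
    rw [← lcMap_comp_apply, show β ∘ₗ U.mkQ = β₀ from U.liftQ_mkQ _ _, h1, lcMap_sum, LinearMap.sum_apply]
    refine Finset.sum_eq_zero fun j _ ↦ ?_
    rw [lcMap_smul, LinearMap.smul_apply, ← map_smul,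
      mem_torsionBySet_ideal.1 t.2 (b j) (hb j), map_zero]
  refine ⟨lcMap J i q, e.symm.toLinearMap ∘ₗ δ,
    s ∘ₗ LinearMap.codRestrict _ (e.toLinearMap ∘ₗ Submodule.subtype _) hrange, ?_, ?_, ?_⟩
  · rw [injective_iff_map_eq_zero]
    intro z hz
    obtain ⟨w, rfl⟩ := (lc_exact_middle J i hφq hφ hq z).1 hz
    rw [hlcφ, LinearMap.zero_apply]
  · intro z
    rw [← lc_exact_right J i hφq hφ hq z, LinearMap.comp_apply, LinearEquiv.coe_coe,
      LinearEquiv.map_eq_zero_iff]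
  · intro t
    obtain ⟨v, hv⟩ := hrange t
    have h1 : LinearMap.codRestrict (LinearMap.range δ')
        (e.toLinearMap ∘ₗ Submodule.subtype _) hrange t = ⟨δ' v, v, rfl⟩ := Subtype.ext hv.symm
    rw [LinearMap.comp_apply, LinearMap.comp_apply, h1, hs, hδ, hv]
    exact e.symm_apply_apply _

end Splitting

/-! ### Parameter elements of generalized Cohen–Macaulay modules and the conclusion. -/

section GeneralizedCohenMacaulay

variable {R : Type u} [CommRing R] [IsLocalRing R] {M : Type u} [AddCommGroup M] [Module R M]
  {d k : ℕ}

lemma AnnihilatesLocalCohomologyBelow.killedBy (h : AnnihilatesLocalCohomologyBelow R M d k)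
    {i : ℕ} (hi : i < d) :
    KilledBy (maximalIdeal R ^ k) (LC (maximalIdeal R) i M) := by
  intro a ha z
  have h1 : a • z ∈ (maximalIdeal R ^ k) • (⊤ : Submodule R (maxLocalCohomology R M i)) :=
    Submodule.smul_mem_smul ha Submodule.mem_top
  rwa [h i hi, Submodule.mem_bot] at h1

variable [IsNoetherianRing R]

/-- The support of `0 :_M x` lies in `Supp M ∩ V(x) = Supp (M/xM)`, so its dimension is less than
`d`, too small for a submodule that is not power torsion. -/
lemma IsParameterElement.isPowTorsion_torsionBy {x : R} (hx : IsParameterElement R M x)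
    [Module.Finite R M] (hdim : Module.supportDim R M = (d : WithBot ℕ∞))
    (h : AnnihilatesLocalCohomologyBelow R M d k) :
    IsPowTorsion (maximalIdeal R) (Submodule.torsionBy R M x) := by
  by_contra htor
  have h1 := natCast_le_supportDim_of_not_isPowTorsion d (fun i hi ↦ h.killedBy hi) _ htor
  have h2 : Module.supportDim R (Submodule.torsionBy R M x) ≤
      Module.supportDim R (QuotSMulTop x M) := by
    have hsub : Module.support R (Submodule.torsionBy R M x) ⊆
        Module.support R (QuotSMulTop x M) := by
      rw [Module.support_quotSMulTop]
      intro p hp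
      refine ⟨Module.support_subset_of_injective _
        (Submodule.torsionBy R M x).injective_subtype hp, ?_⟩
      have := Module.annihilator_le_of_mem_support hp
      rw [PrimeSpectrum.mem_zeroLocus, Set.singleton_subset_iff]
      refine this (Module.mem_annihilator.2 ?_)
      rintro ⟨m, hm⟩
      exact Subtype.ext hm
    exact Order.krullDim_le_of_strictMono (fun p ↦ ⟨p.1, hsub p.2⟩) (fun _ _ hpq ↦ hpq)
  have h3 := hx.2
  rw [hdim] at h3
  have h4 := h1.trans h2
  -- It remains to refute `D + 1 = d ≤ D` in `WithBot ℕ∞`; the infinite values are excluded because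
  -- `d` is a natural number.
  generalize Module.supportDim R (QuotSMulTop x M) = D at h3 h4
  rw [← h3] at h4
  induction D with
  | bot => simp at h3
  | coe D =>
    induction D with
    | top =>
      exact absurd (WithBot.coe_injective h3) (by
        change ¬ ((⊤ : ℕ∞) + 1 = d)
        rw [top_add]
        exact ENat.top_ne_natCast d)
    | coe D =>
      norm_cast at h4
      lia

theorem exists_section_of_isParameterElement {x : R} (hx : IsParameterElement R M x)
    [Module.Finite R M] (hd : 0 < d) (hdim : Module.supportDim R M = (d : WithBot ℕ∞))
    (h : AnnihilatesLocalCohomologyBelow R M d k) (hxk : x ∈ maximalIdeal R ^ (2 * k))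
    {i : ℕ} (hi : i < d) :
    ∃ (f : LC (maximalIdeal R) i M →ₗ[R] LC (maximalIdeal R) i (QuotSMulTop x M))
      (g : LC (maximalIdeal R) i (QuotSMulTop x M) →ₗ[R] LC (maximalIdeal R) (i + 1) M)
      (s : Submodule.torsionBySet R (LC (maximalIdeal R) (i + 1) M)
          ((maximalIdeal R ^ k : Ideal R) : Set R) →ₗ[R]
        LC (maximalIdeal R) i (QuotSMulTop x M)),
      Function.Injective f ∧ Function.Exact f g ∧ ∀ t, g (s t) = t := by
  refine exists_section_lc_quotSMulTop (U := powTorsion (maximalIdeal R) M)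
    isPowTorsion_powTorsion (killedBy_lc_zero_iff.1 (h.killedBy hd))
    (by rwa [← pow_add, ← two_mul]) (fun m hm ↦ ?_) i (h.killedBy hi)
  obtain ⟨t, ht⟩ := hx.isPowTorsion_torsionBy hdim h ⟨m, hm⟩
  exact ⟨t, fun a ha ↦ congrArg Subtype.val (ht a ha)⟩

end GeneralizedCohenMacaulay

theorem corollary4p1 (R : Type u) [CommRing R] [IsLocalRing R] [IsNoetherianRing R]
    (M : Type u) [AddCommGroup M] [Module R M] (d : ℕ)
    (hM : IsGeneralizedCohenMacaulay R M d) :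
    (∀ n₀ : ℕ, IsLeast {k : ℕ | 0 < k ∧ AnnihilatesLocalCohomologyBelow R M d k} n₀ →
      ∀ x : R, IsParameterElement R M x → x ∈ maximalIdeal R ^ (2 * n₀) →
        (∀ i : ℕ, i < d - 1 →
          Nonempty (maxLocalCohomology R (QuotSMulTop x M) i ≃ₗ[R]
            maxLocalCohomology R M i × maxLocalCohomology R M (i + 1))) ∧
        Nonempty (annihilatedByMaxPow R (maxLocalCohomology R (QuotSMulTop x M) (d - 1)) n₀ ≃ₗ[R]
          maxLocalCohomology R M (d - 1) ×
            annihilatedByMaxPow R (maxLocalCohomology R M d) n₀)) ∧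
    (∃ n : ℕ, 0 < n ∧ ∀ x : R, IsParameterElement R M x → x ∈ maximalIdeal R ^ n →
      ∀ i : ℕ, i < d - 1 →
        Nonempty (maxLocalCohomology R (QuotSMulTop x M) i ≃ₗ[R]
          maxLocalCohomology R M i × maxLocalCohomology R M (i + 1))) := by
  have := hM.finite
  -- Minimality of `n₀` plays no role: any annihilating exponent `k` works, which also gives the
  -- final claim with `n = 2 * k`.
  have key : ∀ k : ℕ, AnnihilatesLocalCohomologyBelow R M d k →
      ∀ x : R, IsParameterElement R M x → x ∈ maximalIdeal R ^ (2 * k) → ∀ i : ℕ, i < d - 1 →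
        Nonempty (maxLocalCohomology R (QuotSMulTop x M) i ≃ₗ[R]
          maxLocalCohomology R M i × maxLocalCohomology R M (i + 1)) := by
    intro k hk x hx hxk i hi
    obtain ⟨f, g, s, hf, hfg, hs⟩ :=
      exists_section_of_isParameterElement hx hM.pos hM.dim_eq hk hxk (i := i) (by lia)
    exact nonempty_equiv_prod hf hfg hs (hk.killedBy (by lia))
  refine ⟨fun n₀ hn₀ x hx hxn ↦ ⟨key n₀ hn₀.1.2 x hx hxn, ?_⟩, ?_⟩
  -- The dimension becomes `0 + d + 1`, so that degree `i + 1` is literally the top degree for `i =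
  -- 0 + d`. There `H^{i+1}(M)` need not be killed, so only the parts killed by the ideal are
  -- compared.
  · obtain ⟨d, rfl⟩ := Nat.exists_eq_add_of_lt hM.pos
    obtain ⟨f, g, s, hf, hfg, hs⟩ := exists_section_of_isParameterElement hx hM.pos hM.dim_eq
      hn₀.1.2 hxn (i := 0 + d) (by lia)
    exact nonempty_torsionBySet_equiv_prod hf hfg hs (hn₀.1.2.killedBy (by lia))
  · obtain ⟨k, hk0, hk⟩ := hM.exists_annihilates
    exact ⟨2 * k, by lia, key k hk⟩
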